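/- **Norms.** For $s\in[0,1)$ let $\|f\|_{C^s(\mathbb R^d)}$ be the usual Hölder norm (the sup norm of a continuous function if $s=0$; the sup norm plus the $s$-Hölder seminorm if $s>0$). For $s<0$ set recursively $$\|f\|_{C^s(\mathbb R^d)}:=\inf_{\nabla\cdot g=f}\|g\|_{C^{s+1}(\mathbb R^d)},$$ where the divergence is taken in the sense of distributions, $g$ has one more index than $f$, and the infimum over the empty set is $+\infty$. **Solutions.** For $u:[0,1]\times\mathbb R^2\to\mathbb R^2$ smooth on $(0,1]\times\mathbb R^2$, $W\in C^0((0,1],\mathbb R^2)$, $s\in(0,1]$ and $y\in\mathbb R^2$, denote by $t\mapsto X^{s,y,u,W}_t$, $t\in[s,1]$, the solution of $$X_t=y+\int_s^t u(r,X_r)\,dr+W_t-W_s .$$ **Explosive separation.** A random velocity field $u$ with law $\mathbb P$ is *explosively separating* for a sequence of times $T^n\in(0,1]$ with $T^n\to0$ and a path $W$ if $$\lim_{n\to\infty}\ \limsup_{\delta\to0^+}\ \limsup_{|x-y|\to0,\ x\ne y}\ \limsup_{m\to\infty}\ \mathbb P\big(|X^{T^m,x,u,W}_{T^n}-X^{T^m,y,u,W}_{T^n}|<\delta\big)=0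 .$$ **Theorem 1.6.** 1. For every real $\alpha<1/2$ there is a random velocity field $v^\alpha:[0,1]\times\mathbb R^2\to\mathbb R^2$ such that, surely, $\|v^\alpha(t,\cdot)\|_{C^\alpha(\mathbb R^2)}\le2$ for all $t\in[0,1]$, $v^\alpha\in C^\infty_{\mathrm{loc}}((0,1]\times\mathbb R^2)$, and the solutions $X^{s,y,v^\alpha,W}$ exist on $[s,1]$ and are unique for all $W\in C^0((0,1],\mathbb R^2)$, $s\in(0,1]$, $y\in\mathbb R^2$; and there is a deterministic sequence of times $T^n\in(0,1]$, $T^n\to0$, such that for every $\beta$ with $\frac1{2(1-\alpha)}<\beta\le1$ and every deterministic $W\in C^\beta([0,1],\mathbb R^2)$ (Lipschitz if $\beta=1$), $v^\alpha$ is explosively separating for $(T^n)$ and $W$. 2. For every $\rho\in(0,1/2)$ there is a random velocity field $u^\rho:[0,1]\times\mathbb R^2\to\mathbb R^2$ such that, surely, $\|u^\rho(t,\cdot)\|_{C^{-\rho}(\mathbb R^2)}\le2$ for all $t\in[0,1]$, $u^\rho\in L^1([0,1],C^0(\mathbb R^2))\cap C^\infty_{\mathrm{loc}}((0,1]\times\mathbb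 R^2)$, and the solutions $X^{s,y,u^\rho,W}$ exist on $[s,1]$ and are unique for all $W\in C^0((0,1],\mathbb R^2)$, $s\in(0,1]$, $y\in\mathbb R^2$; and there is a deterministic sequence of times $T^n\in(0,1]$, $T^n\to0$, such that for every deterministic $W\in C^{\frac{1+\rho/8}{2+\rho/2}}([0,1],\mathbb R^2)$, $u^\rho$ is explosively separating for $(T^n)$ and $W$. -/

import Mathlib

open Set Filter Topology MeasureTheory
open scoped NNReal ENNReal Distributions

noncomputable section

namespace ExplosiveSeparation

/-- Euclidean space `ℝ^d` with the Euclidean norm. -/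
abbrev Space (d : ℕ) : Type := EuclideanSpace ℝ (Fin d)

/-! ### Hölder norms of order less than one, negative orders included -/

section Norms

variable {d : ℕ} {F : Type} [NormedAddCommGroup F] [NormedSpace ℝ F]

/-- The usual Hölder norm of order `r ∈ [0, 1)` of a function on `ℝ^d`, with values in `[0, ∞]`:
the sup norm if `r = 0`, the sup norm plus the Hölder seminorm if `r > 0`, and `∞` for
discontinuous functions. -/
def holderNorm (r : ℝ) (f : Space d → F) : ℝ≥0∞ :=
  open Classical in
  if Continuous f then
    (⨆ x, ‖f x‖ₑ) + (if r = 0 then 0 else eHolderNorm r.toNNReal f)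
  else ∞

/-- The distribution `T` on `ℝ^d` is given by integration against the locally integrable
function `f`. -/
def Represents (T : 𝓓'((⊤ : TopologicalSpace.Opens (Space d)), F)) (f : Space d → F) : Prop :=
  LocallyIntegrable f volume ∧
    ∀ φ : 𝓓((⊤ : TopologicalSpace.Opens (Space d)), ℝ), T φ = ∫ x, φ x • f x

/-- The distributional divergence `∑ i, ∂ᵢ gᵢ` of a distribution `g = (g₁, …, g_d)` whose
components are `F`-valued. The space `F^d` carries the `ℓ²` norm, so that iterating the
construction produces tensors with the Euclidean (Frobenius) norm. -/
def divergence
    (g : 𝓓'((⊤ : TopologicalSpace.Opens (Space d)), PiLp 2 (fun _ : Fin d => F))) :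
    𝓓'((⊤ : TopologicalSpace.Opens (Space d)), F) :=
  ∑ i : Fin d, Distribution.lineDerivCLM (EuclideanSpace.single i (1 : ℝ))
    (Distribution.mapCLM (PiLp.proj 2 (𝕜 := ℝ) (fun _ : Fin d => F) i) g)

end Norms

/-- The recursion behind the norms of negative order: `k` is the number of times a divergence has
to be inverted before the order `s + k` is nonnegative. -/
def distNormAux {d : ℕ} : (k : ℕ) → (s : ℝ) →
    {F : Type} → [NormedAddCommGroup F] → [NormedSpace ℝ F] →
    𝓓'((⊤ : TopologicalSpace.Opens (Space d)), F) → ℝ≥0∞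
  | 0, s, F, _, _, T => ⨅ (f : Space d → F) (_ : Represents T f), holderNorm s f
  | k + 1, s, F, _, _, T =>
      ⨅ (g : 𝓓'((⊤ : TopologicalSpace.Opens (Space d)), PiLp 2 (fun _ : Fin d => F)))
        (_ : divergence g = T), distNormAux k (s + 1) g

/-- The `C^s` norm, `s < 1`, of a distribution on `ℝ^d`: the Hölder norm if `0 ≤ s`, and
`‖T‖_{C^s} = inf {‖g‖_{C^{s+1}} : ∇ · g = T}` recursively if `s < 0`. -/
def distNorm {d : ℕ} {F : Type} [NormedAddCommGroup F] [NormedSpace ℝ F] (s : ℝ)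
    (T : 𝓓'((⊤ : TopologicalSpace.Opens (Space d)), F)) : ℝ≥0∞ :=
  distNormAux ⌈-s⌉₊ s T

/-- The `C^s` norm, `s < 1`, of a function on `ℝ^d`. For `s < 0` the function is regarded as a
distribution (the norm is `∞` if it is not locally integrable). -/
def cNorm {d : ℕ} {F : Type} [NormedAddCommGroup F] [NormedSpace ℝ F] (s : ℝ)
    (f : Space d → F) : ℝ≥0∞ :=
  open Classical in
  if 0 ≤ s then holderNorm s f
  else ⨅ (T : 𝓓'((⊤ : TopologicalSpace.Opens (Space d)), F)) (_ : Represents T f), distNorm s T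

/-! ### Velocity fields and driving paths on the time interval `[0, 1]` -/

section Fields

variable {d : ℕ}

/-- `u ∈ C^∞_loc((0, 1] × ℝ^d)`. -/
def SmoothPositiveTimes (u : ℝ → Space d → Space d) : Prop :=
  ContDiffOn ℝ ((⊤ : ℕ∞) : WithTop ℕ∞) (fun p : ℝ × Space d => u p.1 p.2) (Ioc 0 1 ×ˢ univ)

/-- `u ∈ L¹([0, 1], C⁰(ℝ^d))` in the sense of Bochner, `C⁰(ℝ^d)` being the Banach space of
bounded continuous functions with the sup norm. -/
def MemL1C0 (u : ℝ → Space d → Space d) : Prop :=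
  ∃ U : ℝ → BoundedContinuousFunction (Space d) (Space d),
    IntegrableOn U (Icc 0 1) volume ∧
      ∀ᵐ t ∂(volume.restrict (Icc (0 : ℝ) 1)), ∀ x, U t x = u t x

/-- `W ∈ C^β([0, 1], ℝ^d)` for `0 < β ≤ 1`. -/
def HolderPath (β : ℝ) (W : ℝ → Space d) : Prop :=
  ∃ C : ℝ≥0, HolderOnWith C β.toNNReal W (Icc 0 1)

/-- `X` solves `dX_t = u(t, X_t) dt + dW_t`, `X_s = y`, on `[s, 1]`. -/
def IsSolution (u : ℝ → Space d → Space d) (W : ℝ → Space d) (s : ℝ) (y : Space d)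
    (X : ℝ → Space d) : Prop :=
  ContinuousOn X (Icc s 1) ∧
    ∀ t ∈ Icc s 1, X t = y + (∫ r in s..t, u r (X r)) + (W t - W s)

/-- For every continuous driving path, every initial time `s ∈ (0, 1]` and every initial
position, there is exactly one solution on `[s, 1]`. -/
def UniquelySolvable (u : ℝ → Space d → Space d) : Prop :=
  ∀ W : ℝ → Space d, ContinuousOn W (Ioc 0 1) → ∀ s ∈ Ioc (0 : ℝ) 1, ∀ y : Space d,
    ∃ X : ℝ → Space d, IsSolution u W s y X ∧ ∀ Y, IsSolution u W s y Y → EqOn Y X (Icc s 1)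

/-- The solution `t ↦ X^{s,y,u,W}_t`, `t ∈ [s, 1]` (only meaningful if a unique solution
exists). -/
def solution (u : ℝ → Space d → Space d) (W : ℝ → Space d) (s : ℝ) (y : Space d) :
    ℝ → Space d :=
  open Classical in
  if h : ∃ X, IsSolution u W s y X then h.choose else fun _ => y

/-- The filter `|x - y| → 0` on pairs of distinct points. -/
def closePairs (d : ℕ) : Filter (Space d × Space d) :=
  comap (fun p => ‖p.1 - p.2‖) (𝓝[>] 0)

/-- A random velocity field, defined on the probability space `(Ω, P)`, is explosively separating
for the times `T` and the path `W`. -/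
def ExplosivelySeparating {Ω : Type} [MeasurableSpace Ω] (P : Measure Ω)
    (u : Ω → ℝ → Space d → Space d) (T : ℕ → ℝ) (W : ℝ → Space d) : Prop :=
  Tendsto (fun n : ℕ =>
    limsup (fun δ : ℝ =>
      limsup (fun p : Space d × Space d =>
        limsup (fun m : ℕ =>
          P {ω | ‖solution (u ω) W (T m) p.1 (T n) - solution (u ω) W (T m) p.2 (T n)‖ < δ})
          atTop)
        (closePairs d))
      (𝓝[>] 0))
    atTop (𝓝 0)

end Fields

end ExplosiveSeparation

end

/-! The field is a sequence of sinusoidal shears acting on disjoint time intervals that accumulate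
at time 0. Shears are numbered backwards in time, and each has an independent, uniform choice among
four directions and four phases. A shear displaces particles orthogonally to its frequency vector,
so along a solution its phase changes only through `W`, and its flow map is explicit
(`solution_step`, `solution_eq_flow`).

Let D be the difference of two particles, L the length scale of the shear and κ its strength, i.e.
amplitude times effective duration over L. The inverse distance is a Lyapunov function: if `W`
oscillates by at most L/8 during the shear, then averaging over the 16 choices gives E|D'|⁻¹ ≤ (1 -
κ²/64)|D|⁻¹ + 8κ²/L (`average_inv_norm_le`, `average_stepMap_le`). Opposite phases cancel the
first-order term, quarter-turn phases make the second-order term independent of position, and the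
four directions give that term a negative sign. If the scales grow slowly enough forward in time,
the bound E|D|⁻¹ ≤ 1024/L propagates from shear to shear (`lintegral_inv_norm_le`). It holds
initially for any two distinct points once the starting scale is small enough, and Markov's
inequality bounds the probability of ending closer than δ by 1024δ/L (`noise_norm_lt_le`), uniformly
in the starting points and times.

The scales balance three demands. The norm of order α fixes the amplitude as L^α/2. Strengths
500/√(n+1) have barely divergent squares, which pays for polynomial growth of the scales. This
forces L to be proportional to (step·√(n+1))^σ with σ = 1/(1-α), and the oscillation of `W` over a
step must be smaller than L. Logarithmic times have steps close to 1/n, so β > σ/2 is enough; power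
times additionally make amplitude times step summable, which gives integrability in time.
Negative-order norms are computable because inverting the divergence of a plane wave gives a plane
wave (`cNorm_planeWave_le`). -/

noncomputable section
namespace ExplosiveSeparation

/-! ### Norms of plane waves -/

section PlaneWave

variable {d : ℕ} {F : Type} [NormedAddCommGroup F] [NormedSpace ℝ F]

/-- The plane wave `x ↦ sin (⟪x, ν⟫ + φ) w`. -/
def planeWave (ν : Space d) (φ : ℝ) (w : F) (x : Space d) : F :=
  Real.sin (inner ℝ x ν + φ) • w

lemma continuous_planeWave (ν : Space d) (φ : ℝ) (w : F) : Continuous (planeWave ν φ w) := by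
  unfold planeWave; fun_prop

lemma norm_planeWave_le (ν : Space d) (φ : ℝ) (w : F) (x : Space d) :
    ‖planeWave ν φ w x‖ ≤ ‖w‖ := by
  rw [planeWave, norm_smul, Real.norm_eq_abs]
  exact mul_le_of_le_one_left (norm_nonneg _) (Real.abs_sin_le_one _)

lemma abs_sin_sub_sin_le (a b : ℝ) : |Real.sin a - Real.sin b| ≤ |a - b| := by
  have := Real.lipschitzWith_sin.dist_le_mul a b
  simpa [Real.dist_eq] using this

/-- Interpolation: at distance at least one the trivial bound 2 is enough, and below that the
Lipschitz bound is, since lowering the exponent of a number in [0, 1] increases the power. -/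
lemma abs_sin_sub_sin_le_rpow {r : ℝ} (h0 : 0 ≤ r) (h1 : r ≤ 1) (a b : ℝ) :
    |Real.sin a - Real.sin b| ≤ 2 * |a - b| ^ r := by
  rcases le_total 1 |a - b| with h | h
  · have h2 := Real.one_le_rpow h h0
    have h3 := abs_sub (Real.sin a) (Real.sin b)
    linarith [Real.abs_sin_le_one a, Real.abs_sin_le_one b]
  · have h2 := Real.rpow_le_rpow_of_exponent_ge' (abs_nonneg (a - b)) h h0 h1
    rw [Real.rpow_one] at h2
    linarith [abs_sin_sub_sin_le a b, abs_nonneg (a - b)]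

lemma holderNorm_planeWave_le {ν : Space d} (hν : 1 ≤ ‖ν‖) (φ : ℝ) (w : F) {r : ℝ}
    (h0 : 0 ≤ r) (h1 : r ≤ 1) :
    holderNorm r (planeWave ν φ w) ≤ ENNReal.ofReal (3 * ‖ν‖ ^ r * ‖w‖) := by
  have hr : 1 ≤ ‖ν‖ ^ r := Real.one_le_rpow hν h0
  rw [holderNorm, if_pos (continuous_planeWave ν φ w)]
  have hsplit : 3 * ‖ν‖ ^ r * ‖w‖ = ‖ν‖ ^ r * ‖w‖ + 2 * ‖ν‖ ^ r * ‖w‖ := by ring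
  rw [hsplit, ENNReal.ofReal_add (by positivity) (by positivity)]
  refine add_le_add ?_ ?_
  · refine iSup_le fun x => ?_
    rw [← ofReal_norm]
    refine ENNReal.ofReal_le_ofReal ((norm_planeWave_le ν φ w x).trans ?_)
    exact le_mul_of_one_le_left (norm_nonneg _) hr
  · split_ifs
    · exact zero_le
    · refine HolderWith.eHolderNorm_le (C := (2 * ‖ν‖ ^ r * ‖w‖).toNNReal) ?_
      intro x y
      rw [edist_dist, edist_dist, Real.coe_toNNReal r h0, ENNReal.ofReal_rpow_of_nonneg dist_nonneg h0,
        ← ENNReal.ofReal, ← ENNReal.ofReal_mul (by positivity)]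
      refine ENNReal.ofReal_le_ofReal ?_
      rw [dist_eq_norm, planeWave, planeWave, ← sub_smul, norm_smul, Real.norm_eq_abs]
      have h2 := abs_sin_sub_sin_le_rpow h0 h1 (inner ℝ x ν + φ) (inner ℝ y ν + φ)
      have h3 : |inner ℝ x ν + φ - (inner ℝ y ν + φ)| ≤ dist x y * ‖ν‖ := by
        rw [add_sub_add_right_eq_sub, ← inner_sub_left, dist_eq_norm]
        exact abs_real_inner_le_norm _ _
      have h4 := Real.rpow_le_rpow (abs_nonneg _) h3 h0
      rw [Real.mul_rpow dist_nonneg (norm_nonneg _)] at h4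
      calc _ ≤ 2 * (dist x y ^ r * ‖ν‖ ^ r) * ‖w‖ := by
            gcongr; linarith
        _ = _ := by ring

/-- The distribution given by a plane wave. -/
def planeWaveDistribution (ν : Space d) (φ : ℝ) (w : F) :
    𝓓'((⊤ : TopologicalSpace.Opens (Space d)), F) :=
  ContinuousLinearMap.toUniformConvergenceCLM _ _ _
    (((1 : ℝ →L[ℝ] ℝ).smulRight w).comp
      (TestFunction.integralAgainstBilinCLM (ContinuousLinearMap.mul ℝ ℝ) volume
        (fun x : Space d => Real.sin (inner ℝ x ν + φ))))

lemma planeWaveDistribution_apply (ν : Space d) (φ : ℝ) (w : F)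
    (f : 𝓓((⊤ : TopologicalSpace.Opens (Space d)), ℝ)) :
    planeWaveDistribution ν φ w f = (∫ x, f x * Real.sin (inner ℝ x ν + φ)) • w := by
  have h : LocallyIntegrableOn (fun x : Space d => Real.sin (inner ℝ x ν + φ))
      ((⊤ : TopologicalSpace.Opens (Space d)) : Set (Space d)) volume := by
    refine LocallyIntegrable.locallyIntegrableOn ?_ _
    exact Continuous.locallyIntegrable (by fun_prop)
  change (TestFunction.integralAgainstBilinCLM (ContinuousLinearMap.mul ℝ ℝ) volume
        (fun x : Space d => Real.sin (inner ℝ x ν + φ)) f) • w = _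
  rw [TestFunction.integralAgainstBilinCLM_eq_integral h]
  rfl

lemma represents_planeWave [CompleteSpace F] (ν : Space d) (φ : ℝ) (w : F) :
    Represents (planeWaveDistribution ν φ w) (planeWave ν φ w) := by
  refine ⟨(continuous_planeWave ν φ w).locallyIntegrable, fun f => ?_⟩
  rw [planeWaveDistribution_apply, ← integral_smul_const]
  simp_rw [planeWave, mul_smul]

/-- The tensor whose divergence against `ν` is `w`. -/
def invertTensor (ν : Space d) (w : F) : PiLp 2 (fun _ : Fin d => F) :=
  WithLp.toLp 2 fun i => (ν i / ‖ν‖ ^ 2) • w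

lemma norm_invertTensor {ν : Space d} (hν : ν ≠ 0) (w : F) :
    ‖invertTensor ν w‖ = ‖w‖ / ‖ν‖ := by
  have h0 : ‖ν‖ ≠ 0 := norm_ne_zero_iff.2 hν
  rw [PiLp.norm_eq_of_L2, invertTensor]
  have : ∑ i, ‖(ν i / ‖ν‖ ^ 2) • w‖ ^ 2 = (‖w‖ / ‖ν‖) ^ 2 := by
    have h1 : ∀ i, ‖(ν i / ‖ν‖ ^ 2) • w‖ ^ 2 = ‖ν i‖ ^ 2 * (‖w‖ ^ 2 / ‖ν‖ ^ 4) := by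
      intro i
      rw [norm_smul, norm_div, norm_pow, norm_norm]
      field_simp
    simp_rw [h1]
    rw [← Finset.sum_mul, ← EuclideanSpace.norm_sq_eq]
    field_simp
  simp only [this]
  exact Real.sqrt_sq (by positivity)

/-- Integration by parts. Delaying the phase by a quarter turn makes the derivative of the sine the
original sine again, so no cosine waves are needed. -/
lemma integral_lineDeriv_mul_sin (ν : Space d) (φ : ℝ) (v : Space d)
    (f : 𝓓((⊤ : TopologicalSpace.Opens (Space d)), ℝ)) :
    ∫ x, (TestFunction.lineDerivCLM ℝ v f : 𝓓((⊤ : TopologicalSpace.Opens (Space d)), ℝ)) x *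
        Real.sin (inner ℝ x ν + (φ - Real.pi / 2)) =
      - (inner ℝ v ν * ∫ x, f x * Real.sin (inner ℝ x ν + φ)) := by
  have hg : ∀ x, HasFDerivAt (fun x : Space d => Real.sin (inner ℝ x ν + (φ - Real.pi / 2)))
      (Real.sin (inner ℝ x ν + φ) • (innerSL ℝ ν)) x := by
    intro x
    have h1 : HasFDerivAt (fun x : Space d => inner ℝ x ν + (φ - Real.pi / 2))
        (innerSL ℝ ν) x := by
      have := ((innerSL ℝ ν).hasFDerivAt (x := x)).add_const (φ - Real.pi / 2)
      simpa [real_inner_comm] using this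
    have h2 := h1.sin
    rwa [← add_sub_assoc, Real.cos_sub_pi_div_two] at h2
  have hf : Differentiable ℝ f := f.contDiff.differentiable (by simp)
  have hf' : Continuous fun x => fderiv ℝ f x v :=
    (f.contDiff.continuous_fderiv (by simp)).clm_apply continuous_const
  have hsupp : HasCompactSupport fun x => fderiv ℝ f x v :=
    f.hasCompactSupport.fderiv_apply ℝ v
  have key := integral_mul_fderiv_eq_neg_fderiv_mul_of_integrable (μ := volume) (𝕜 := ℝ)
    (f := f) (g := fun x : Space d => Real.sin (inner ℝ x ν + (φ - Real.pi / 2))) (v := v)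
    (Continuous.integrable_of_hasCompactSupport (by fun_prop) hsupp.mul_right)
    (by
      simp_rw [fun x => (hg x).fderiv]
      exact Continuous.integrable_of_hasCompactSupport
        (f.continuous.mul (by simp only [smul_apply]; fun_prop))
        f.hasCompactSupport.mul_right)
    (Continuous.integrable_of_hasCompactSupport (f.continuous.mul (by fun_prop))
      f.hasCompactSupport.mul_right)
    (fun x _ => hf x) (fun x _ => (hg x).differentiableAt)
  have hL : ∀ x, (TestFunction.lineDerivCLM ℝ v f :
      𝓓((⊤ : TopologicalSpace.Opens (Space d)), ℝ)) x = fderiv ℝ f x v := fun x => by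
    rw [TestFunction.lineDerivCLM_apply_of_le (by simp)]
    exact (hf x).lineDeriv_eq_fderiv
  simp_rw [hL]
  rw [← neg_eq_iff_eq_neg] at key
  rw [← key, ← integral_const_mul]
  congr 1
  refine integral_congr_ae (Eventually.of_forall fun x => ?_)
  beta_reduce
  rw [(hg x).fderiv, smul_apply, innerSL_apply_apply, smul_eq_mul, real_inner_comm v ν]
  ring

/-- Plane waves are closed under inverting the divergence: the phase is delayed by a quarter turn
and the amplitude is divided by the frequency. -/
lemma divergence_planeWaveDistribution {ν : Space d} (hν : ν ≠ 0) (φ : ℝ) (w : F) :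
    divergence (planeWaveDistribution ν (φ - Real.pi / 2) (invertTensor ν w)) =
      planeWaveDistribution ν φ w := by
  have h0 : ‖ν‖ ≠ 0 := norm_ne_zero_iff.2 hν
  ext f
  have hsum : ∑ i, ν i * (ν i / ‖ν‖ ^ 2) = 1 := by
    have := EuclideanSpace.norm_sq_eq ν
    simp_rw [← mul_div_assoc, ← Finset.sum_div, ← sq]
    simp_rw [Real.norm_eq_abs, sq_abs] at this
    rw [← this]
    field_simp
  calc divergence (planeWaveDistribution ν (φ - Real.pi / 2) (invertTensor ν w)) f
      = ∑ i : Fin d, (Distribution.lineDerivCLM (EuclideanSpace.single i (1 : ℝ))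
        (Distribution.mapCLM (PiLp.proj 2 (𝕜 := ℝ) (fun _ : Fin d => F) i)
          (planeWaveDistribution ν (φ - Real.pi / 2) (invertTensor ν w))) :
            𝓓'((⊤ : TopologicalSpace.Opens (Space d)), F)) f := by
        rw [divergence]
        exact map_sum (M := 𝓓'((⊤ : TopologicalSpace.Opens (Space d)), F)) (N := F)
          (AddMonoidHom.mk' (fun T : 𝓓'((⊤ : TopologicalSpace.Opens (Space d)), F) => T f)
            (fun _ _ => rfl)) _ _
    _ = ∑ i : Fin d, (ν i * (ν i / ‖ν‖ ^ 2)) • ((∫ x, f x * Real.sin (inner ℝ x ν + φ)) • w) := by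
        refine Finset.sum_congr rfl fun i _ => ?_
        rw [Distribution.lineDerivCLM_apply, Distribution.mapCLM_apply,
          planeWaveDistribution_apply, integral_lineDeriv_mul_sin, ← map_neg, ← neg_smul, neg_neg]
        simp only [map_smul, PiLp.proj_apply, invertTensor, EuclideanSpace.inner_single_left,
          smul_smul]
        simp
        congr 1
        ring
    _ = planeWaveDistribution ν φ w f := by
        rw [← Finset.sum_smul, hsum, one_smul, planeWaveDistribution_apply]

/-- Each inversion raises the order by one and divides the amplitude by ‖ν‖, so ‖ν‖ ^ s * ‖w‖ is
invariant under the recursion and the constant 3 of the Hölder case survives. -/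
lemma distNormAux_planeWave_le {ν : Space d} (hν : 1 ≤ ‖ν‖) (k : ℕ) :
    ∀ {F : Type} [NormedAddCommGroup F] [NormedSpace ℝ F] [CompleteSpace F] (s φ : ℝ) (w : F),
      0 ≤ s + k → s + k ≤ 1 →
      distNormAux k s (planeWaveDistribution ν φ w) ≤ ENNReal.ofReal (3 * ‖ν‖ ^ s * ‖w‖) := by
  have hpos : 0 < ‖ν‖ := by linarith
  induction k with
  | zero =>
    intro F _ _ _ s φ w h0 h1
    rw [distNormAux]
    refine iInf₂_le_of_le _ (represents_planeWave ν φ w) ?_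
    exact holderNorm_planeWave_le hν φ w (by simpa using h0) (by simpa using h1)
  | succ k ih =>
    intro F _ _ _ s φ w h0 h1
    push_cast at h0 h1
    rw [distNormAux]
    refine iInf₂_le_of_le _ (divergence_planeWaveDistribution (norm_pos_iff.1 hpos) φ w) ?_
    refine (ih (s + 1) _ _ (by linarith) (by linarith)).trans (ENNReal.ofReal_le_ofReal ?_)
    rw [norm_invertTensor (norm_pos_iff.1 hpos), Real.rpow_add_one hpos.ne']
    field_simp
    rfl

/-- The Hölder norm, of any order less than one, of a plane wave of high frequency. -/
theorem cNorm_planeWave_le [CompleteSpace F] {ν : Space d} (hν : 1 ≤ ‖ν‖) {s : ℝ} (hs : s ≤ 1) (φ : ℝ) (w : F) :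
    cNorm s (planeWave ν φ w) ≤ ENNReal.ofReal (3 * ‖ν‖ ^ s * ‖w‖) := by
  rw [cNorm]
  split_ifs with h
  · exact holderNorm_planeWave_le hν φ w h hs
  · refine iInf₂_le_of_le _ (represents_planeWave ν φ w) ?_
    rw [distNorm]
    have h1 := Nat.le_ceil (-s)
    have h2 := Nat.ceil_lt_add_one (show 0 ≤ -s by linarith)
    exact distNormAux_planeWave_le hν _ s φ w (by linarith) (by linarith)

end PlaneWave

/-! ### One random shear decreases the inverse distance on average -/

/-- Second-order Taylor expansion with a cubic error. Inverting and squaring reduce it to polynomial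
inequalities, one for each sign of x. -/
lemma inv_sqrt_one_add_le {x : ℝ} (hx : -(1 / 2) ≤ x) :
    (√(1 + x))⁻¹ ≤ 1 - x / 2 + 3 / 8 * x ^ 2 + |x| ^ 3 := by
  have h1 : 0 < 1 + x := by linarith
  have hp : 0 < 1 - x / 2 + 3 / 8 * x ^ 2 + |x| ^ 3 := by
    have := pow_nonneg (abs_nonneg x) 3
    nlinarith [sq_nonneg (x - 1 / 2)]
  rw [inv_le_comm₀ (Real.sqrt_pos.2 h1) hp]
  refine Real.le_sqrt_of_sq_le ?_
  rw [inv_pow, inv_le_comm₀ (by positivity) h1, inv_eq_one_div, div_le_iff₀ h1]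
  rcases le_total 0 x with h | h
  · rw [abs_of_nonneg h]
    have e : (1 - x / 2 + 3 / 8 * x ^ 2 + x ^ 3) ^ 2 * (1 + x) =
        1 + x ^ 3 * (21 / 8 + 49 / 64 * x - 7 / 64 * x ^ 2 + 7 / 4 * x ^ 3 + x ^ 4) := by ring
    rw [e]
    have : 0 ≤ x ^ 3 * (21 / 8 + 49 / 64 * x - 7 / 64 * x ^ 2 + 7 / 4 * x ^ 3 + x ^ 4) := by
      refine mul_nonneg (by positivity) ?_
      nlinarith [sq_nonneg (x ^ 2 - 1), pow_nonneg h 3]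
    linarith
  · obtain ⟨y, rfl⟩ : ∃ y, x = -y := ⟨-x, by ring⟩
    rw [abs_neg, abs_of_nonneg (by linarith)]
    have hy : 0 ≤ y := by linarith
    have hy' : y ≤ 1 / 2 := by linarith
    have e : (1 - -y / 2 + 3 / 8 * (-y) ^ 2 + y ^ 3) ^ 2 * (1 + -y) =
        1 + y ^ 3 * (11 / 8 - 79 / 64 * y - 25 / 64 * y ^ 2 + 1 / 4 * y ^ 3 - y ^ 4) := by ring
    rw [e]
    have h2 : y ^ 2 ≤ (1 / 2) ^ 2 := pow_le_pow_left₀ hy hy' 2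
    have h4 : y ^ 4 ≤ (1 / 2) ^ 4 := pow_le_pow_left₀ hy hy' 4
    have h3 : 0 ≤ y ^ 3 := by positivity
    have : 0 ≤ y ^ 3 * (11 / 8 - 79 / 64 * y - 25 / 64 * y ^ 2 + 1 / 4 * y ^ 3 - y ^ 4) := by
      refine mul_nonneg h3 ?_
      nlinarith
    linarith

/-- Here p and m are the components of the separation along and across the shear, and s is the
relative displacement. Adding the two signs cancels the first-order term and leaves the second
derivative of the inverse distance along the shear. The numerical constants are not sharp. -/
lemma inv_sqrt_add_inv_sqrt_le {p m q κ s : ℝ} (hq : 0 < q) (hpm : p ^ 2 + m ^ 2 = q)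
    (h0 : 0 ≤ κ) (h1 : κ ≤ 1 / 100) (hs : s ^ 2 ≤ κ ^ 2 * m ^ 2) :
    (√(q + 2 * p * s + s ^ 2))⁻¹ + (√(q - 2 * p * s + s ^ 2))⁻¹ ≤
      (√q)⁻¹ * (2 + s ^ 2 * (2 * p ^ 2 - m ^ 2) / q ^ 2 + 56 * κ ^ 3) := by
  have hs' : s ^ 2 ≤ κ ^ 2 * q := hs.trans (by gcongr; nlinarith)
  have hps : (p * s) ^ 2 ≤ (κ * q) ^ 2 := by
    rw [mul_pow, mul_pow]
    calc p ^ 2 * s ^ 2 ≤ q * (κ ^ 2 * q) := by gcongr; nlinarith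
      _ = _ := by ring
  have hps' : |p * s| ≤ κ * q := abs_le_of_sq_le_sq hps (by positivity)
  have hκ2 : κ ^ 2 ≤ κ / 100 := by nlinarith
  have bound : ∀ r : ℝ, r = 2 * p * s ∨ r = -(2 * p * s) →
      (√(q + r + s ^ 2))⁻¹ ≤ (√q)⁻¹ * (1 - (r + s ^ 2) / q / 2 + 3 / 8 * ((r + s ^ 2) / q) ^ 2 +
        27.3 * κ ^ 3) := by
    intro r hr
    have hr' : |r| ≤ 2 * (κ * q) := by
      rcases hr with rfl | rfl
      · rw [mul_assoc, abs_mul, abs_two]; linarith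
      · rw [abs_neg, mul_assoc, abs_mul, abs_two]; linarith
    have hx : |(r + s ^ 2) / q| ≤ 2.01 * κ := by
      rw [abs_div, abs_of_pos hq, div_le_iff₀ hq]
      calc |r + s ^ 2| ≤ |r| + |s ^ 2| := abs_add_le _ _
        _ ≤ 2 * (κ * q) + κ ^ 2 * q := by rw [abs_of_nonneg (sq_nonneg s)]; linarith
        _ ≤ 2 * (κ * q) + κ / 100 * q := by gcongr
        _ = _ := by ring
    have e : q + r + s ^ 2 = q * (1 + (r + s ^ 2) / q) := by field_simp; ring
    rw [e, Real.sqrt_mul hq.le, mul_inv]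
    refine mul_le_mul_of_nonneg_left ?_ (by positivity)
    refine (inv_sqrt_one_add_le (by linarith [(abs_le.1 hx).1])).trans ?_
    have : |(r + s ^ 2) / q| ^ 3 ≤ (2.01 * κ) ^ 3 := pow_le_pow_left₀ (abs_nonneg _) hx 3
    nlinarith [pow_nonneg h0 3]
  have b1 := bound _ (Or.inl rfl)
  have b2 := bound _ (Or.inr rfl)
  rw [← sub_eq_add_neg] at b2
  refine (add_le_add b1 b2).trans ?_
  rw [← mul_add]
  refine mul_le_mul_of_nonneg_left ?_ (by positivity)
  have e : (1 - (2 * p * s + s ^ 2) / q / 2 + 3 / 8 * ((2 * p * s + s ^ 2) / q) ^ 2 +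
        27.3 * κ ^ 3) + (1 - (-(2 * p * s) + s ^ 2) / q / 2 +
        3 / 8 * ((-(2 * p * s) + s ^ 2) / q) ^ 2 + 27.3 * κ ^ 3) =
      2 + s ^ 2 * (3 * p ^ 2 - q) / q ^ 2 + 3 / 4 * (s ^ 2 / q) ^ 2 + 54.6 * κ ^ 3 := by
    field_simp; ring
  rw [e]
  have h4 : (s ^ 2 / q) ^ 2 ≤ (κ ^ 2) ^ 2 := by
    gcongr
    rwa [div_le_iff₀ hq]
  have h5 : 3 * p ^ 2 - q = 2 * p ^ 2 - m ^ 2 := by rw [← hpm]; ring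
  rw [h5]
  nlinarith [pow_nonneg h0 3]

/-- The four shear directions. -/
def dir (j : Fin 4) : Space 2 :=
  ![!₂[1, 0], !₂[0, 1], !₂[(√2)⁻¹, (√2)⁻¹], !₂[-(√2)⁻¹, (√2)⁻¹]] j

/-- The unit vectors orthogonal to the shear directions. -/
def nrm (j : Fin 4) : Space 2 := dir (![1, 0, 3, 2] j)

lemma inv_sqrt_two_sq : (√2 : ℝ)⁻¹ ^ 2 = 1 / 2 := by
  rw [inv_pow, Real.sq_sqrt (by norm_num)]; norm_num

lemma norm_dir (j : Fin 4) : ‖dir j‖ = 1 := by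
  have h := inv_sqrt_two_sq
  rw [EuclideanSpace.norm_eq, Real.sqrt_eq_one]
  fin_cases j <;> simp [dir, Fin.sum_univ_two] <;> norm_num

lemma norm_nrm (j : Fin 4) : ‖nrm j‖ = 1 := norm_dir _

lemma inner_dir_nrm (j : Fin 4) : inner ℝ (dir j) (nrm j) = 0 := by
  fin_cases j <;> simp [dir, nrm, PiLp.inner_apply, Fin.sum_univ_two]

lemma inner_dir_sq (D : Space 2) :
    inner ℝ D (dir 0) ^ 2 = D 0 ^ 2 ∧ inner ℝ D (dir 1) ^ 2 = D 1 ^ 2 ∧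
      inner ℝ D (dir 2) ^ 2 = (D 0 + D 1) ^ 2 / 2 ∧
      inner ℝ D (dir 3) ^ 2 = (D 0 - D 1) ^ 2 / 2 := by
  have h := inv_sqrt_two_sq
  refine ⟨?_, ?_, ?_, ?_⟩ <;> simp [dir, PiLp.inner_apply, Fin.sum_univ_two]
  · linear_combination (D 0 + D 1) ^ 2 * h
  · linear_combination (D 0 - D 1) ^ 2 * h

lemma inner_dir_sq_add (D : Space 2) (j : Fin 4) :
    inner ℝ D (dir j) ^ 2 + inner ℝ D (nrm j) ^ 2 = ‖D‖ ^ 2 := by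
  obtain ⟨h0, h1, h2, h3⟩ := inner_dir_sq D
  rw [EuclideanSpace.norm_sq_eq, Fin.sum_univ_two]
  simp only [Real.norm_eq_abs, sq_abs]
  fin_cases j <;> simp [nrm, h0, h1, h2, h3] <;> ring

/-- Source of the negative drift. With D at angle θ to the shear, the summand is ‖D‖⁴(2 sin²θ cos²θ
- sin⁴θ), whose mean over the circle is -1/8 of ‖D‖⁴. Four directions at spacing π/4 integrate the
harmonics of order 2 and 4 exactly, so the discrete average has no dependence on the angle. -/
lemma sum_inner_quartic (D : Space 2) :
    ∑ j, inner ℝ D (nrm j) ^ 2 * (2 * inner ℝ D (dir j) ^ 2 - inner ℝ D (nrm j) ^ 2) =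
      -(‖D‖ ^ 2) ^ 2 / 2 := by
  obtain ⟨h0, h1, h2, h3⟩ := inner_dir_sq D
  rw [EuclideanSpace.norm_sq_eq, Fin.sum_univ_two, Fin.sum_univ_four]
  simp only [Real.norm_eq_abs, sq_abs]
  simp [nrm, h0, h1, h2, h3]
  ring

lemma norm_add_smul_dir (D : Space 2) (j : Fin 4) (s : ℝ) :
    ‖D + s • dir j‖ = √(‖D‖ ^ 2 + 2 * inner ℝ D (dir j) * s + s ^ 2) := by
  rw [← Real.sqrt_sq (norm_nonneg (D + s • dir j)), norm_add_sq_real, norm_smul, norm_dir,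
    inner_smul_right, mul_one, Real.norm_eq_abs, sq_abs]
  congr 1
  ring

lemma average_direction_le {D : Space 2} (hD : D ≠ 0) (j : Fin 4) {κ a b : ℝ} (h0 : 0 ≤ κ)
    (h1 : κ ≤ 1 / 100) (hab : a ^ 2 + b ^ 2 ≤ κ ^ 2 * inner ℝ D (nrm j) ^ 2) :
    ‖D + a • dir j‖⁻¹ + ‖D + b • dir j‖⁻¹ + ‖D + (-a) • dir j‖⁻¹ + ‖D + (-b) • dir j‖⁻¹ ≤
      ‖D‖⁻¹ * (4 + (a ^ 2 + b ^ 2) * (2 * inner ℝ D (dir j) ^ 2 - inner ℝ D (nrm j) ^ 2) /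
        (‖D‖ ^ 2) ^ 2 + 112 * κ ^ 3) := by
  have hq : 0 < ‖D‖ ^ 2 := by positivity
  have ha := inv_sqrt_add_inv_sqrt_le hq (inner_dir_sq_add D j) h0 h1
    ((le_add_of_nonneg_right (sq_nonneg b)).trans hab)
  have hb := inv_sqrt_add_inv_sqrt_le hq (inner_dir_sq_add D j) h0 h1
    ((le_add_of_nonneg_left (sq_nonneg a)).trans hab)
  rw [Real.sqrt_sq (norm_nonneg D)] at ha hb
  simp only [norm_add_smul_dir, mul_neg, neg_sq, ← sub_eq_add_neg]
  calc _ = _ := by ring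
    _ ≤ _ := add_le_add ha hb
    _ = _ := by ring

/-- Drift inequality for the inverse distance of two particles under a random shear. -/
theorem average_inv_norm_le {D : Space 2} (hD : D ≠ 0) {κ L : ℝ} (hL : 0 < L) (h0 : 0 ≤ κ)
    (h1 : κ ≤ 1 / 4000) {a b : Fin 4 → ℝ}
    (hab : ∀ j, a j ^ 2 + b j ^ 2 ≤ κ ^ 2 * inner ℝ D (nrm j) ^ 2)
    (hlow : ‖D‖ ≤ L / 4 → ∀ j, (1 - 1 / 32) * (κ ^ 2 * inner ℝ D (nrm j) ^ 2) ≤ a j ^ 2 + b j ^ 2) :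
    (∑ j, (‖D + a j • dir j‖⁻¹ + ‖D + b j • dir j‖⁻¹ + ‖D + (-a j) • dir j‖⁻¹ +
      ‖D + (-b j) • dir j‖⁻¹)) / 16 ≤ (1 - κ ^ 2 / 64) * ‖D‖⁻¹ + 8 * κ ^ 2 / L := by
  have hq : 0 < ‖D‖ ^ 2 := by positivity
  have hV : 0 < ‖D‖⁻¹ := by positivity
  have hκ3 : κ ^ 3 ≤ κ ^ 2 / 4000 := by nlinarith [sq_nonneg κ]
  have hj : ∀ j, inner ℝ D (nrm j) ^ 2 ≤ ‖D‖ ^ 2 := fun j => by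
    nlinarith [inner_dir_sq_add D j, sq_nonneg (inner ℝ D (dir j) : ℝ)]
  have hj' : ∀ j, inner ℝ D (dir j) ^ 2 ≤ ‖D‖ ^ 2 := fun j => by
    nlinarith [inner_dir_sq_add D j, sq_nonneg (inner ℝ D (nrm j) : ℝ)]
  have hsum := Finset.sum_le_sum fun j (_ : j ∈ Finset.univ) =>
    average_direction_le hD j h0 (h1.trans (by norm_num)) (hab j)
  rw [← Finset.mul_sum] at hsum
  -- Close particles see an almost linear shear. The drift is -κ²/2 in the sum over directions; the
  -- defect 1/32 in the lower bound costs at most κ²/8, and the cubic terms, as κ ≤ 1/4000, at most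
  -- another κ²/8. Distant particles may drift the wrong way, but there the inverse distance is
  -- below 4/L and the loss goes into the additive term.
  rcases le_or_gt ‖D‖ (L / 4) with hs | hs
  · have hterm : ∀ j, (a j ^ 2 + b j ^ 2) * (2 * inner ℝ D (dir j) ^ 2 - inner ℝ D (nrm j) ^ 2) /
        (‖D‖ ^ 2) ^ 2 ≤ κ ^ 2 * (inner ℝ D (nrm j) ^ 2 *
          (2 * inner ℝ D (dir j) ^ 2 - inner ℝ D (nrm j) ^ 2)) / (‖D‖ ^ 2) ^ 2 + κ ^ 2 / 32 := by
      intro j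
      rw [← sub_le_iff_le_add', ← sub_div, div_le_iff₀ (by positivity)]
      have hl := hlow hs j
      have hu := hab j
      have hm := hj j
      have hp := sq_nonneg (inner ℝ D (dir j) : ℝ)
      have hm0 := sq_nonneg (inner ℝ D (nrm j) : ℝ)
      generalize inner ℝ D (dir j) ^ 2 = p at *
      generalize inner ℝ D (nrm j) ^ 2 = m at *
      generalize a j ^ 2 + b j ^ 2 = G at *
      generalize ‖D‖ ^ 2 = q at *
      have e1 : κ ^ 2 * m * m ≤ κ ^ 2 * q ^ 2 := by
        rw [mul_assoc, ← sq]; gcongr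
      nlinarith [mul_nonneg hp (sub_nonneg.2 hu), mul_nonneg hm0 (sub_nonneg.2 hl)]
    have hsum2 : ∑ j : Fin 4, (4 + (a j ^ 2 + b j ^ 2) *
        (2 * inner ℝ D (dir j) ^ 2 - inner ℝ D (nrm j) ^ 2) / (‖D‖ ^ 2) ^ 2 + 112 * κ ^ 3) ≤
        16 - κ ^ 2 / 4 := by
      calc _ ≤ ∑ j : Fin 4, (4 + (κ ^ 2 * (inner ℝ D (nrm j) ^ 2 *
          (2 * inner ℝ D (dir j) ^ 2 - inner ℝ D (nrm j) ^ 2)) / (‖D‖ ^ 2) ^ 2 + κ ^ 2 / 32) +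
            112 * κ ^ 3) := Finset.sum_le_sum fun j _ => by linarith [hterm j]
        _ = 16 + κ ^ 2 * (-(‖D‖ ^ 2) ^ 2 / 2) / (‖D‖ ^ 2) ^ 2 + κ ^ 2 / 8 + 448 * κ ^ 3 := by
          rw [← sum_inner_quartic]
          simp only [Finset.sum_add_distrib, ← Finset.sum_div, ← Finset.mul_sum]
          simp
          ring
        _ = 16 - κ ^ 2 / 2 + κ ^ 2 / 8 + 448 * κ ^ 3 := by field_simp; ring
        _ ≤ _ := by linarith [sq_nonneg κ]
    have h3 := hsum.trans (mul_le_mul_of_nonneg_left hsum2 hV.le)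
    have h4 : 0 ≤ 8 * κ ^ 2 / L := by positivity
    linarith
  · have hterm : ∀ j, (a j ^ 2 + b j ^ 2) * (2 * inner ℝ D (dir j) ^ 2 - inner ℝ D (nrm j) ^ 2) /
        (‖D‖ ^ 2) ^ 2 ≤ 2 * κ ^ 2 := by
      intro j
      rw [div_le_iff₀ (by positivity)]
      have hu := hab j
      have hm := hj j
      have hp' := hj' j
      have hp := sq_nonneg (inner ℝ D (dir j) : ℝ)
      have hm0 := sq_nonneg (inner ℝ D (nrm j) : ℝ)
      have hG : 0 ≤ a j ^ 2 + b j ^ 2 := by positivity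
      calc _ ≤ (a j ^ 2 + b j ^ 2) * (2 * ‖D‖ ^ 2) := by gcongr; linarith
        _ ≤ (κ ^ 2 * ‖D‖ ^ 2) * (2 * ‖D‖ ^ 2) := by gcongr; exact hu.trans (by gcongr)
        _ = _ := by ring
    have hsum2 : ∑ j : Fin 4, (4 + (a j ^ 2 + b j ^ 2) *
        (2 * inner ℝ D (dir j) ^ 2 - inner ℝ D (nrm j) ^ 2) / (‖D‖ ^ 2) ^ 2 + 112 * κ ^ 3) ≤
        16 + 9 * κ ^ 2 := by
      calc _ ≤ ∑ j : Fin 4, (4 + 2 * κ ^ 2 + 112 * κ ^ 3) :=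
            Finset.sum_le_sum fun j _ => by linarith [hterm j]
        _ ≤ _ := by simp; linarith [sq_nonneg κ]
    have h3 := hsum.trans (mul_le_mul_of_nonneg_left hsum2 hV.le)
    have h4 : ‖D‖⁻¹ ≤ 4 / L := by
      rw [inv_le_comm₀ (by positivity) (by positivity), inv_div]; exact hs.le
    have h5 : κ ^ 2 * ‖D‖⁻¹ ≤ κ ^ 2 * (4 / L) := by gcongr
    have h6 : 8 * κ ^ 2 / L = 2 * (κ ^ 2 * (4 / L)) := by ring
    rw [h6]
    nlinarith [mul_nonneg (sq_nonneg κ) hV.le]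

/-! ### Unique solvability -/

section Solvability

variable {d : ℕ} {u : ℝ → Space d → Space d} {W : ℝ → Space d} {s : ℝ} {y : Space d}

/-- Subtracting the increment of `W` turns the equation into an ordinary differential equation with
continuous coefficients, although `W` need not be differentiable. -/
lemma isSolution_iff_eq_picard {X : ℝ → Space d} (hW : ContinuousOn W (Icc s 1)) :
    IsSolution u W s y X ↔ ContinuousOn (fun t => X t - (W t - W s)) (Icc s 1) ∧
      ∀ t ∈ Icc s 1, X t - (W t - W s) = ODE.picard (fun t z => u t (z + (W t - W s))) s y
        (fun t => X t - (W t - W s)) t := by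
  have hW' : ContinuousOn (fun t => W t - W s) (Icc s 1) := hW.sub continuousOn_const
  refine and_congr ⟨fun h => h.sub hW', fun h => ?_⟩ (forall₂_congr fun t _ => ?_)
  · exact (h.add hW').congr fun t _ => by simp
  · simp only [ODE.picard_apply, sub_add_cancel]
    rw [sub_eq_iff_eq_add]

/-- A continuous field which is bounded and Lipschitz in space, locally uniformly in positive
times, is uniquely solvable. -/
theorem uniquelySolvable_of_lipschitz
    (hu : ContinuousOn (Function.uncurry u) (Ioc 0 1 ×ˢ univ))
    (hb : ∀ s ∈ Ioc (0 : ℝ) 1, ∃ K B : ℝ≥0, ∀ t ∈ Icc s 1,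
      LipschitzWith K (u t) ∧ ∀ x, ‖u t x‖ ≤ B) :
    UniquelySolvable u := by
  intro W hW s hs y
  obtain ⟨K, B, hKB⟩ := hb s hs
  have hsub : Icc s 1 ⊆ Ioc 0 1 := fun t ht => ⟨hs.1.trans_le ht.1, ht.2⟩
  have hWs : ContinuousOn W (Icc s 1) := hW.mono hsub
  set f : ℝ → Space d → Space d := fun t z => u t (z + (W t - W s)) with hf
  have hfc : ContinuousOn (Function.uncurry f) (Icc s 1 ×ˢ univ) := by
    have h1 : ContinuousOn (fun p : ℝ × Space d => (p.1, p.2 + (W p.1 - W s)))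
        (Icc s 1 ×ˢ univ) :=
      continuousOn_fst.prodMk (continuousOn_snd.add
        ((hWs.comp continuousOn_fst fun p hp => hp.1).sub continuousOn_const))
    exact hu.comp h1 fun p hp => ⟨hsub hp.1, mem_univ _⟩
  have hlip : ∀ t ∈ Icc s 1, LipschitzWith K (f t) := by
    intro t ht x z
    simpa [hf] using (hKB t ht).1 (x + (W t - W s)) (z + (W t - W s))
  have hs1 : s ∈ Icc s 1 := ⟨le_rfl, hs.2⟩
  -- The radius B is never exceeded, because the speed is at most B and the interval has length at
  -- most one. One application therefore covers all of [s, 1].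
  have hPL : IsPicardLindelof f (⟨s, hs1⟩ : Icc s 1) y B 0 B K := by
    refine ⟨fun t ht => (hlip t ht).lipschitzOnWith, fun x _ => ?_, fun t ht x _ => (hKB t ht).2 _,
      ?_⟩
    · exact hfc.comp (continuousOn_id.prodMk continuousOn_const) fun t ht => ⟨ht, mem_univ _⟩
    · simp only [sub_self, NNReal.coe_zero, sub_zero]
      rw [max_eq_left (by linarith [hs.2])]
      exact mul_le_of_le_one_right B.2 (by linarith [hs.1])
  obtain ⟨α, hα0, hα⟩ := hPL.exists_eq_forall_mem_Icc_hasDerivWithinAt₀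
  have hαc : ContinuousOn α (Icc s 1) := fun t ht => (hα t ht).continuousWithinAt
  have hαp : ∀ t ∈ Icc s 1, α t = ODE.picard f s y α t := by
    intro t ht
    have hsubt : uIcc s t ⊆ Icc s 1 := uIcc_subset_Icc hs1 ht
    have := ODE.picard_eq_of_hasDerivAt (u := univ) (hfc.mono (prod_mono_left hsubt))
      (fun t' ht' => (hα t' (hsubt ht')).mono hsubt) (mapsTo_univ _ _)
    rw [← this]
    congr
  have hsol : IsSolution u W s y (fun t => α t + (W t - W s)) := by
    rw [isSolution_iff_eq_picard hWs]
    simp only [add_sub_cancel_right]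
    exact ⟨hαc, hαp⟩
  have hderiv : ∀ Z : ℝ → Space d, ContinuousOn Z (Icc s 1) →
      (∀ t ∈ Icc s 1, Z t = ODE.picard f s y Z t) →
      ∀ t ∈ Ico s 1, HasDerivWithinAt Z (f t (Z t)) (Ici t) t := by
    intro Z hZ hZp t ht
    have h1 := ODE.hasDerivWithinAt_picard_Icc (u := univ) hs1 hfc hZ (fun _ _ => mem_univ _) y
      (Ico_subset_Icc_self ht)
    have h2 := h1.congr hZp (hZp t (Ico_subset_Icc_self ht))
    exact h2.mono_of_mem_nhdsWithin (mem_of_superset (Icc_mem_nhdsGE ht.2)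
      (Icc_subset_Icc_left ht.1))
  refine ⟨_, hsol, fun Y hY t ht => ?_⟩
  rw [isSolution_iff_eq_picard hWs] at hY
  have h := ODE_solution_unique_of_mem_Icc_right (v := f) (K := K) (s := fun _ => univ)
    (fun t ht => (hlip t (Ico_subset_Icc_self ht)).lipschitzOnWith) hY.1 (hderiv _ hY.1 hY.2)
    (fun _ _ => mem_univ _) hαc (hderiv _ hαc hαp) (fun _ _ => mem_univ _)
    (by rw [hY.2 s hs1, hαp s hs1]; simp) ht
  exact sub_eq_iff_eq_add.1 h

lemma UniquelySolvable.isSolution_solution (hu : UniquelySolvable u)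
    (hW : ContinuousOn W (Ioc 0 1)) (hs : s ∈ Ioc (0 : ℝ) 1) (y : Space d) :
    IsSolution u W s y (solution u W s y) := by
  obtain ⟨X, hX, -⟩ := hu W hW s hs y
  have h : ∃ X, IsSolution u W s y X := ⟨X, hX⟩
  rw [solution, dif_pos h]
  exact h.choose_spec

end Solvability

/-! ### Random alternating shear flows -/

/-- A smooth bump function supported in `[0, 1]`. -/
def bump (x : ℝ) : ℝ := expNegInvGlue x * expNegInvGlue (1 - x)

lemma expNegInvGlue_le_one (x : ℝ) : expNegInvGlue x ≤ 1 := by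
  rw [expNegInvGlue]
  split_ifs with h
  · exact zero_le_one
  · exact Real.exp_le_one_iff.2 (by have := inv_pos.2 (not_le.1 h); linarith)

lemma bump_nonneg (x : ℝ) : 0 ≤ bump x :=
  mul_nonneg (expNegInvGlue.nonneg _) (expNegInvGlue.nonneg _)

lemma bump_le_one (x : ℝ) : bump x ≤ 1 :=
  mul_le_one₀ (expNegInvGlue_le_one _) (expNegInvGlue.nonneg _) (expNegInvGlue_le_one _)

lemma bump_eq_zero_of_nonpos {x : ℝ} (h : x ≤ 0) : bump x = 0 := by
  rw [bump, expNegInvGlue.zero_of_nonpos h, zero_mul]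

lemma bump_eq_zero_of_one_le {x : ℝ} (h : 1 ≤ x) : bump x = 0 := by
  rw [bump, expNegInvGlue.zero_of_nonpos (sub_nonpos.2 h), mul_zero]

lemma contDiff_bump : ContDiff ℝ ((⊤ : ℕ∞) : WithTop ℕ∞) bump :=
  expNegInvGlue.contDiff.mul (expNegInvGlue.contDiff.comp (contDiff_const.sub contDiff_id))

lemma continuous_bump : Continuous bump := contDiff_bump.continuous

/-- The integral of the bump function. -/
def bumpMass : ℝ := ∫ x in (0 : ℝ)..1, bump x

lemma bumpMass_pos : 0 < bumpMass := by
  refine intervalIntegral.intervalIntegral_pos_of_pos_on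
    (continuous_bump.intervalIntegrable _ _) (fun x hx => ?_) zero_lt_one
  exact mul_pos (expNegInvGlue.pos_of_pos hx.1) (expNegInvGlue.pos_of_pos (sub_pos.2 hx.2))

/-- The times at which the shears are switched, together with their amplitudes and length scales,
enumerated backwards in time. -/
structure Schedule where
  time : ℕ → ℝ
  amp : ℕ → ℝ
  len : ℕ → ℝ
  time_zero : time 0 = 1
  time_anti : StrictAnti time
  time_tendsto : Tendsto time atTop (𝓝 0)
  amp_nonneg : ∀ n, 0 ≤ amp n
  len_pos : ∀ n, 0 < len n

namespace Schedule

variable (S : Schedule)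

/-- The duration of the `n`-th shear. -/
def step (n : ℕ) : ℝ := S.time n - S.time (n + 1)

lemma step_pos (n : ℕ) : 0 < S.step n := sub_pos.2 (S.time_anti n.lt_succ_self)

lemma time_pos (n : ℕ) : 0 < S.time n :=
  (S.time_anti.antitone.le_of_tendsto S.time_tendsto (n + 1)).trans_lt
    (S.time_anti n.lt_succ_self)

lemma time_le_one (n : ℕ) : S.time n ≤ 1 := by
  rw [← S.time_zero]; exact S.time_anti.antitone n.zero_le

lemma time_mem (n : ℕ) : S.time n ∈ Ioc (0 : ℝ) 1 := ⟨S.time_pos n, S.time_le_one n⟩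

lemma exists_time_lt {t : ℝ} (ht : 0 < t) : ∃ n, S.time n < t :=
  (S.time_tendsto.eventually_lt_const ht).exists

lemma exists_mem_Ioc {t : ℝ} (ht : t ∈ Ioc (0 : ℝ) 1) :
    ∃ n, t ∈ Ioc (S.time (n + 1)) (S.time n) := by
  classical
  have h := S.exists_time_lt ht.1
  have h0 : Nat.find h ≠ 0 := by
    intro h0
    have := Nat.find_spec h
    rw [h0, S.time_zero] at this
    exact absurd this (not_lt.2 ht.2)
  obtain ⟨n, hn⟩ := Nat.exists_eq_succ_of_ne_zero h0
  refine ⟨n, ?_, ?_⟩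
  · have := Nat.find_spec h
    rwa [hn] at this
  · exact not_lt.1 (Nat.find_min h (by rw [hn]; exact n.lt_succ_self))

/-- The time profile of the `n`-th shear. -/
def cutoff (n : ℕ) (t : ℝ) : ℝ := bump ((t - S.time (n + 1)) / S.step n)

lemma cutoff_nonneg (n : ℕ) (t : ℝ) : 0 ≤ S.cutoff n t := bump_nonneg _

lemma cutoff_le_one (n : ℕ) (t : ℝ) : S.cutoff n t ≤ 1 := bump_le_one _

lemma cutoff_eq_zero_of_le {n : ℕ} {t : ℝ} (h : t ≤ S.time (n + 1)) : S.cutoff n t = 0 :=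
  bump_eq_zero_of_nonpos (div_nonpos_of_nonpos_of_nonneg (by linarith) (S.step_pos n).le)

lemma cutoff_eq_zero_of_ge {n : ℕ} {t : ℝ} (h : S.time n ≤ t) : S.cutoff n t = 0 :=
  bump_eq_zero_of_one_le (by rw [le_div_iff₀ (S.step_pos n), step]; linarith)

lemma contDiff_cutoff (n : ℕ) : ContDiff ℝ ((⊤ : ℕ∞) : WithTop ℕ∞) (S.cutoff n) :=
  contDiff_bump.comp ((contDiff_id.sub contDiff_const).div_const _)

lemma continuous_cutoff (n : ℕ) : Continuous (S.cutoff n) := (S.contDiff_cutoff n).continuous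

lemma integral_cutoff (n : ℕ) :
    ∫ t in S.time (n + 1)..S.time n, S.cutoff n t = S.step n * bumpMass := by
  have h := (S.step_pos n).ne'
  simp only [cutoff, sub_div]
  rw [intervalIntegral.integral_comp_div_sub _ h, sub_self, ← sub_div, ← step, div_self h,
    smul_eq_mul, bumpMass]

/-! ### Superposition of pulses with disjoint time supports -/

section PulseSum

variable {E : Type*} [NormedAddCommGroup E] [NormedSpace ℝ E]

/-- The superposition of the time profiles with coefficients `g`. -/
def pulseSum (g : ℕ → E) (t : ℝ) : E := ∑' n, S.cutoff n t • g n

lemma pulseSum_eq_sum (g : ℕ → E) {N : ℕ} {t : ℝ} (ht : S.time N ≤ t) :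
    S.pulseSum g t = ∑ n ∈ Finset.range N, S.cutoff n t • g n := by
  refine tsum_eq_sum fun n hn => ?_
  rw [S.cutoff_eq_zero_of_ge, zero_smul]
  exact (S.time_anti.antitone (by simpa using hn)).trans ht

lemma pulseSum_of_mem (g : ℕ → E) {n : ℕ} {t : ℝ} (ht : t ∈ Icc (S.time (n + 1)) (S.time n)) :
    S.pulseSum g t = S.cutoff n t • g n := by
  refine tsum_eq_single n fun m hm => ?_
  rcases lt_or_gt_of_ne hm with h | h
  · rw [S.cutoff_eq_zero_of_le, zero_smul]
    exact ht.2.trans (S.time_anti.antitone h)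
  · rw [S.cutoff_eq_zero_of_ge, zero_smul]
    exact (S.time_anti.antitone h).trans ht.1

/-- The index and the coefficient depend on t alone. One choice thus serves every position, every
realisation of the noise, and the lift to bounded continuous functions. -/
lemma exists_pulseSum_eq (t : ℝ) :
    ∃ n, ∃ c ∈ Icc (0 : ℝ) 1, ∀ {E : Type} [NormedAddCommGroup E] [NormedSpace ℝ E] (g : ℕ → E),
      S.pulseSum g t = c • g n := by
  by_cases ht : t ∈ Ioc (0 : ℝ) 1
  · obtain ⟨n, hn⟩ := S.exists_mem_Ioc ht
    exact ⟨n, _, ⟨S.cutoff_nonneg n t, S.cutoff_le_one n t⟩,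
      fun g => S.pulseSum_of_mem g (Ioc_subset_Icc_self hn)⟩
  · refine ⟨0, 0, by simp, fun g => ?_⟩
    rw [zero_smul]
    rw [mem_Ioc, not_and_or, not_lt, not_le] at ht
    have h0 : ∀ n, S.cutoff n t = 0 := fun n => by
      rcases ht with h | h
      · exact S.cutoff_eq_zero_of_le (h.trans (S.time_pos _).le)
      · exact S.cutoff_eq_zero_of_ge ((S.time_le_one n).trans h.le)
    simp [pulseSum, h0]

lemma continuousOn_pulseSum (g : ℕ → E) : ContinuousOn (S.pulseSum g) (Ioc 0 1) := by
  intro t ht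
  obtain ⟨N, hN⟩ := S.exists_time_lt ht.1
  refine ContinuousAt.continuousWithinAt ?_
  have : ContinuousAt (fun t => ∑ n ∈ Finset.range N, S.cutoff n t • g n) t :=
    (continuous_finsetSum _ fun n _ => (S.continuous_cutoff n).smul continuous_const).continuousAt
  refine this.congr ?_
  filter_upwards [Ioi_mem_nhds hN] with r hr
  exact (S.pulseSum_eq_sum g (le_of_lt hr)).symm

end PulseSum

/-- The `n`-th shear, with direction and phase `k`. -/
def wave (n : ℕ) (k : Fin 4 × Fin 4) : Space 2 → Space 2 :=
  planeWave ((S.len n)⁻¹ • nrm k.1) (k.2 * (Real.pi / 2)) (S.amp n • dir k.1)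

/-- The random velocity field; `ω n` is the direction and the phase of the `n`-th shear. -/
def field (ω : ℕ → Fin 4 × Fin 4) (t : ℝ) (x : Space 2) : Space 2 :=
  S.pulseSum (fun n => S.wave n (ω n) x) t

/-! ### Regularity, solvability and norm bounds of the field -/

variable (ω : ℕ → Fin 4 × Fin 4)

lemma norm_frequency (n : ℕ) (j : Fin 4) : ‖(S.len n)⁻¹ • nrm j‖ = (S.len n)⁻¹ := by
  rw [norm_smul, norm_nrm, mul_one, Real.norm_of_nonneg (inv_pos.2 (S.len_pos n)).le]

lemma norm_amplitude (n : ℕ) (j : Fin 4) : ‖S.amp n • dir j‖ = S.amp n := by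
  rw [norm_smul, norm_dir, mul_one, Real.norm_of_nonneg (S.amp_nonneg n)]

lemma norm_wave_le (n : ℕ) (k : Fin 4 × Fin 4) (x : Space 2) : ‖S.wave n k x‖ ≤ S.amp n :=
  (norm_planeWave_le _ _ _ x).trans (S.norm_amplitude n k.1).le

lemma lipschitzWith_wave (n : ℕ) (k : Fin 4 × Fin 4) :
    LipschitzWith (S.amp n * (S.len n)⁻¹).toNNReal (S.wave n k) := by
  refine LipschitzWith.of_dist_le' fun x y => ?_
  rw [wave, planeWave, planeWave, dist_eq_norm, ← sub_smul, norm_smul, norm_amplitude,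
    Real.norm_eq_abs]
  have h1 := abs_sin_sub_sin_le (inner ℝ x ((S.len n)⁻¹ • nrm k.1) + k.2 * (Real.pi / 2))
    (inner ℝ y ((S.len n)⁻¹ • nrm k.1) + k.2 * (Real.pi / 2))
  rw [add_sub_add_right_eq_sub, ← inner_sub_left] at h1
  have h2 := abs_real_inner_le_norm (x - y) ((S.len n)⁻¹ • nrm k.1)
  rw [norm_frequency] at h2
  rw [dist_eq_norm]
  calc _ ≤ ‖x - y‖ * (S.len n)⁻¹ * S.amp n :=
        mul_le_mul_of_nonneg_right (h1.trans h2) (S.amp_nonneg n)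
    _ = _ := by ring

lemma continuous_wave (n : ℕ) (k : Fin 4 × Fin 4) : Continuous (S.wave n k) :=
  continuous_planeWave _ _ _

lemma contDiff_wave (n : ℕ) (k : Fin 4 × Fin 4) :
    ContDiff ℝ ((⊤ : ℕ∞) : WithTop ℕ∞) (S.wave n k) := by
  unfold wave planeWave
  exact ((Real.contDiff_sin.comp ((contDiff_id.inner ℝ contDiff_const).add contDiff_const)).smul
    contDiff_const)

theorem smoothPositiveTimes_field : SmoothPositiveTimes (S.field ω) := by
  rintro ⟨t, x⟩ ⟨ht, -⟩
  obtain ⟨N, hN⟩ := S.exists_time_lt ht.1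
  refine ContDiffAt.contDiffWithinAt ?_
  have : ContDiff ℝ ((⊤ : ℕ∞) : WithTop ℕ∞) (fun p : ℝ × Space 2 =>
      ∑ n ∈ Finset.range N, S.cutoff n p.1 • S.wave n (ω n) p.2) :=
    ContDiff.sum fun n _ => ((S.contDiff_cutoff n).comp contDiff_fst).smul
      ((S.contDiff_wave n _).comp contDiff_snd)
  refine this.contDiffAt.congr_of_eventuallyEq ?_
  have hmem : {p : ℝ × Space 2 | S.time N < p.1} ∈ 𝓝 (t, x) :=
    (isOpen_lt continuous_const continuous_fst).mem_nhds hN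
  filter_upwards [hmem] with p hp
  exact S.pulseSum_eq_sum _ (le_of_lt hp)

/-- Only finitely many shears are active after a positive time, so summing their sup bounds and
Lipschitz constants gives bounds uniform on [s, 1]. -/
theorem uniquelySolvable_field : UniquelySolvable (S.field ω) := by
  refine uniquelySolvable_of_lipschitz (S.smoothPositiveTimes_field ω).continuousOn fun s hs => ?_
  obtain ⟨N, hN⟩ := S.exists_time_lt hs.1
  refine ⟨∑ n ∈ Finset.range N, (S.amp n * (S.len n)⁻¹).toNNReal,
    ∑ n ∈ Finset.range N, (S.amp n).toNNReal, fun t ht => ?_⟩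
  have hf : S.field ω t = fun x => ∑ n ∈ Finset.range N, S.cutoff n t • S.wave n (ω n) x :=
    funext fun x => S.pulseSum_eq_sum _ (hN.le.trans ht.1)
  have hc : ∀ n, ‖S.cutoff n t‖ ≤ 1 := fun n => by
    rw [Real.norm_of_nonneg (S.cutoff_nonneg n t)]; exact S.cutoff_le_one n t
  rw [hf]
  refine ⟨?_, fun x => ?_⟩
  · refine LipschitzWith.of_dist_le_mul fun x y => ?_
    push_cast
    rw [Finset.sum_mul]
    refine (dist_sum_sum_le _ _ _).trans (Finset.sum_le_sum fun n _ => ?_)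
    rw [dist_smul₀]
    exact (mul_le_of_le_one_left dist_nonneg (hc n)).trans ((S.lipschitzWith_wave n _).dist_le_mul x y)
  · push_cast
    refine (norm_sum_le _ _).trans (Finset.sum_le_sum fun n _ => ?_)
    rw [norm_smul, Real.coe_toNNReal _ (S.amp_nonneg n)]
    exact (mul_le_of_le_one_left (norm_nonneg _) (hc n)).trans (S.norm_wave_le n _ x)

/-- The bound on the norm of order `α` of the field at a fixed time. -/
theorem cNorm_field_le {α : ℝ} (hα : α ≤ 1) (hlen : ∀ n, S.len n ≤ 1)
    (hamp : ∀ n, S.amp n ≤ S.len n ^ α / 2) (t : ℝ) : cNorm α (S.field ω t) ≤ 2 := by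
  obtain ⟨n, c, hc, h⟩ := S.exists_pulseSum_eq t
  have hf : S.field ω t = planeWave ((S.len n)⁻¹ • nrm (ω n).1) ((ω n).2 * (Real.pi / 2))
      ((c * S.amp n) • dir (ω n).1) := by
    funext x
    rw [field, h, wave, planeWave, planeWave, smul_comm, mul_smul]
  have hL := S.len_pos n
  have hν : 1 ≤ ‖(S.len n)⁻¹ • nrm (ω n).1‖ := by
    rw [norm_frequency]; exact (one_le_inv₀ hL).2 (hlen n)
  rw [hf]
  refine (cNorm_planeWave_le hν hα _ _).trans ?_
  rw [norm_frequency, norm_smul, norm_dir, mul_one,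
    Real.norm_of_nonneg (mul_nonneg hc.1 (S.amp_nonneg n)), Real.inv_rpow hL.le]
  refine ENNReal.ofReal_le_of_le_toReal ?_
  have h1 : c * S.amp n ≤ S.len n ^ α / 2 :=
    (mul_le_of_le_one_left (S.amp_nonneg n) hc.2).trans (hamp n)
  calc 3 * (S.len n ^ α)⁻¹ * (c * S.amp n) ≤ 3 * (S.len n ^ α)⁻¹ * (S.len n ^ α / 2) := by gcongr
    _ = 3 / 2 := by field_simp
    _ ≤ _ := by norm_num

lemma measurable_field (t : ℝ) (x : Space 2) : Measurable fun ω => S.field ω t x := by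
  obtain ⟨n, c, -, h⟩ := S.exists_pulseSum_eq t
  simp only [field, h]
  exact (Measurable.of_discrete (f := fun k => c • S.wave n k x)).comp (measurable_pi_apply n)

/-- The shears as bounded continuous functions. -/
def waveBCF (n : ℕ) (k : Fin 4 × Fin 4) : BoundedContinuousFunction (Space 2) (Space 2) :=
  BoundedContinuousFunction.ofNormedAddCommGroup (S.wave n k) (S.continuous_wave n k) (S.amp n)
    (S.norm_wave_le n k)

theorem memL1C0_field (hsum : Summable fun n => S.amp n * S.step n) : MemL1C0 (S.field ω) := by
  refine ⟨S.pulseSum fun n => S.waveBCF n (ω n), ?_, Eventually.of_forall fun t x => ?_⟩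
  · have hcont := S.continuousOn_pulseSum fun n => S.waveBCF n (ω n)
    have hsub : ∀ n, Ioc (S.time (n + 1)) (S.time n) ⊆ Ioc 0 1 := fun n =>
      Ioc_subset_Ioc (S.time_pos _).le (S.time_le_one n)
    have hbound : ∀ n, ∀ t ∈ Ioc (S.time (n + 1)) (S.time n),
        ‖S.pulseSum (fun n => S.waveBCF n (ω n)) t‖ ≤ S.amp n := by
      intro n t ht
      rw [S.pulseSum_of_mem _ (Ioc_subset_Icc_self ht), norm_smul,
        Real.norm_of_nonneg (S.cutoff_nonneg n t)]
      refine (mul_le_of_le_one_left (norm_nonneg _) (S.cutoff_le_one n t)).trans ?_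
      exact BoundedContinuousFunction.norm_ofNormedAddCommGroup_le _ (S.amp_nonneg n) _
    have hunion : Ioc (0 : ℝ) 1 = ⋃ n, Ioc (S.time (n + 1)) (S.time n) :=
      Subset.antisymm (fun t ht => mem_iUnion.2 (S.exists_mem_Ioc ht)) (iUnion_subset hsub)
    have hInt : ∀ n, IntegrableOn (S.pulseSum fun n => S.waveBCF n (ω n))
        (Ioc (S.time (n + 1)) (S.time n)) := fun n =>
      Integrable.of_bound ((hcont.mono (hsub n)).aestronglyMeasurable measurableSet_Ioc) (S.amp n)
        ((ae_restrict_iff' measurableSet_Ioc).2 (Eventually.of_forall (hbound n)))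
    refine IntegrableOn.congr_set_ae ?_ Ioc_ae_eq_Icc.symm
    rw [hunion]
    refine integrableOn_iUnion_of_summable_integral_norm hInt
      (Summable.of_nonneg_of_le (fun n => integral_nonneg fun t => norm_nonneg _) (fun n => ?_)
        hsum)
    have h1 := setIntegral_mono_on (hInt n).norm (integrableOn_const (by simp) (by simp))
      measurableSet_Ioc (hbound n)
    refine h1.trans ?_
    rw [setIntegral_const, smul_eq_mul, measureReal_def, Real.volume_Ioc, ← step,
      ENNReal.toReal_ofReal (S.step_pos n).le, mul_comm]
  · obtain ⟨n, c, -, h⟩ := S.exists_pulseSum_eq t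
    rw [field, h, h]
    rfl

end Schedule

namespace Schedule

variable (S : Schedule) (W : ℝ → Space 2)

/-! ### The flow map of a shear -/

/-- The phase shift of the `n`-th shear in direction `j` due to the driving path. -/
def phaseShift (n : ℕ) (j : Fin 4) (r : ℝ) : ℝ :=
  inner ℝ (W r - W (S.time (n + 1))) ((S.len n)⁻¹ • nrm j)

/-- The in-phase part of the displacement. -/
def cosPart (n : ℕ) (j : Fin 4) : ℝ :=
  ∫ r in S.time (n + 1)..S.time n, S.cutoff n r * Real.cos (S.phaseShift W n j r)

/-- The out-of-phase part of the displacement. -/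
def sinPart (n : ℕ) (j : Fin 4) : ℝ :=
  ∫ r in S.time (n + 1)..S.time n, S.cutoff n r * Real.sin (S.phaseShift W n j r)

/-- The effective duration of the `n`-th shear. -/
def duration (n : ℕ) : ℝ := S.step n * bumpMass

lemma duration_pos (n : ℕ) : 0 < S.duration n := mul_pos (S.step_pos n) bumpMass_pos

/-- The phase of the `n`-th shear at the point `x`. -/
def phase (n : ℕ) (k : Fin 4 × Fin 4) (x : Space 2) : ℝ :=
  inner ℝ x ((S.len n)⁻¹ • nrm k.1) + k.2 * (Real.pi / 2)

/-- The flow map from time `S.time (n + 1)` to time `S.time n`. -/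
def stepMap (n : ℕ) (k : Fin 4 × Fin 4) (x : Space 2) : Space 2 :=
  x + (W (S.time n) - W (S.time (n + 1))) +
    (S.amp n * (Real.sin (S.phase n k x) * S.cosPart W n k.1 +
      Real.cos (S.phase n k x) * S.sinPart W n k.1)) • dir k.1

/-- The composition of the flow maps of `k` shears, ending at time `S.time n`. -/
def flow (ω : ℕ → Fin 4 × Fin 4) : ℕ → ℕ → Space 2 → Space 2
  | 0, _, x => x
  | k + 1, n, x => S.stepMap W n (ω n) (flow ω k (n + 1) x)

variable {W}

lemma time_succ_le (n : ℕ) : S.time (n + 1) ≤ S.time n := (S.time_anti n.lt_succ_self).le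

lemma Icc_time_subset (n : ℕ) : Icc (S.time (n + 1)) (S.time n) ⊆ Icc 0 1 :=
  Icc_subset_Icc (S.time_pos _).le (S.time_le_one n)

lemma continuousOn_phaseShift (hW : ContinuousOn W (Icc 0 1)) (n : ℕ) (j : Fin 4) :
    ContinuousOn (S.phaseShift W n j) (Icc (S.time (n + 1)) (S.time n)) :=
  ((hW.mono (S.Icc_time_subset n)).sub continuousOn_const).inner (𝕜 := ℝ) continuousOn_const

lemma intervalIntegrable_cutoff_mul {f : ℝ → ℝ} {n : ℕ}
    (hf : ContinuousOn f (Icc (S.time (n + 1)) (S.time n))) :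
    IntervalIntegrable (fun r => S.cutoff n r * f r) volume (S.time (n + 1)) (S.time n) := by
  refine ContinuousOn.intervalIntegrable ?_
  rw [uIcc_of_le (S.time_succ_le n)]
  exact (S.continuous_cutoff n).continuousOn.mul hf

lemma intervalIntegrable_cos (hW : ContinuousOn W (Icc 0 1)) (n : ℕ) (j : Fin 4) :
    IntervalIntegrable (fun r => S.cutoff n r * Real.cos (S.phaseShift W n j r)) volume
      (S.time (n + 1)) (S.time n) :=
  S.intervalIntegrable_cutoff_mul
    (Real.continuous_cos.comp_continuousOn (S.continuousOn_phaseShift hW n j))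

lemma intervalIntegrable_sin (hW : ContinuousOn W (Icc 0 1)) (n : ℕ) (j : Fin 4) :
    IntervalIntegrable (fun r => S.cutoff n r * Real.sin (S.phaseShift W n j r)) volume
      (S.time (n + 1)) (S.time n) :=
  S.intervalIntegrable_cutoff_mul
    (Real.continuous_sin.comp_continuousOn (S.continuousOn_phaseShift hW n j))

lemma integral_cutoff_mul_sin (hW : ContinuousOn W (Icc 0 1)) (n : ℕ) (j : Fin 4) (a : ℝ) :
    ∫ r in S.time (n + 1)..S.time n, S.cutoff n r * Real.sin (a + S.phaseShift W n j r) =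
      Real.sin a * S.cosPart W n j + Real.cos a * S.sinPart W n j := by
  rw [cosPart, sinPart, ← intervalIntegral.integral_const_mul,
    ← intervalIntegral.integral_const_mul, ← intervalIntegral.integral_add
      ((S.intervalIntegrable_cos hW n j).const_mul _)
      ((S.intervalIntegrable_sin hW n j).const_mul _)]
  refine intervalIntegral.integral_congr fun r _ => ?_
  rw [Real.sin_add]
  ring

lemma solution_increment {ω : ℕ → Fin 4 × Fin 4} {s : ℝ} {y : Space 2}
    {X : ℝ → Space 2} (hX : IsSolution (S.field ω) W s y X) (hs : 0 < s) {n : ℕ}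
    (hsn : s ≤ S.time (n + 1)) {t : ℝ} (ht : t ∈ Icc (S.time (n + 1)) (S.time n)) :
    X t = X (S.time (n + 1)) + (W t - W (S.time (n + 1))) +
      (S.amp n * ∫ r in S.time (n + 1)..t,
        S.cutoff n r * Real.sin (S.phase n (ω n) (X r))) • dir (ω n).1 := by
  have hcont : ContinuousOn (fun r => S.field ω r (X r)) (Icc s 1) :=
    ContinuousOn.comp (g := fun p : ℝ × Space 2 => S.field ω p.1 p.2) (f := fun r => (r, X r))
      (S.smoothPositiveTimes_field ω).continuousOn (continuousOn_id.prodMk hX.1) fun t ht => ⟨⟨hs.trans_le ht.1, ht.2⟩, mem_univ _⟩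
  have hInt : ∀ a ∈ Icc s 1, ∀ b ∈ Icc s 1,
      IntervalIntegrable (fun r => S.field ω r (X r)) volume a b := fun a ha b hb =>
    (hcont.mono (uIcc_subset_Icc ha hb)).intervalIntegrable
  have hs₀ : s ∈ Icc s 1 := ⟨le_rfl, hsn.trans (S.time_le_one _)⟩
  have hs₁ : S.time (n + 1) ∈ Icc s 1 := ⟨hsn, S.time_le_one _⟩
  have hst : t ∈ Icc s 1 := ⟨hsn.trans ht.1, ht.2.trans (S.time_le_one n)⟩
  have h1 := intervalIntegral.integral_add_adjacent_intervals (hInt s hs₀ _ hs₁)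
    (hInt _ hs₁ t hst)
  have h2 : ∫ r in S.time (n + 1)..t, S.field ω r (X r) =
      ∫ r in S.time (n + 1)..t, (S.cutoff n r * Real.sin (S.phase n (ω n) (X r))) •
        (S.amp n • dir (ω n).1) := by
    refine intervalIntegral.integral_congr fun r hr => ?_
    rw [uIcc_of_le ht.1] at hr
    beta_reduce
    rw [field, S.pulseSum_of_mem _ ⟨hr.1, hr.2.trans ht.2⟩, wave, planeWave, mul_smul, phase]
  rw [intervalIntegral.integral_smul_const, smul_smul, mul_comm] at h2
  rw [hX.2 t hst, hX.2 _ hs₁, ← h1, h2]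
  abel

/-- The shear velocity is orthogonal to its own frequency, so the phase along the solution is the
initial phase plus the shift caused by `W`. The time integral then no longer involves the unknown
solution. -/
lemma solution_step (hW : ContinuousOn W (Icc 0 1)) {ω : ℕ → Fin 4 × Fin 4} {s : ℝ} {y : Space 2}
    {X : ℝ → Space 2} (hX : IsSolution (S.field ω) W s y X) (hs : 0 < s) {n : ℕ}
    (hsn : s ≤ S.time (n + 1)) :
    X (S.time n) = S.stepMap W n (ω n) (X (S.time (n + 1))) := by
  have hphase : ∀ t ∈ Icc (S.time (n + 1)) (S.time n), S.phase n (ω n) (X t) =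
      S.phase n (ω n) (X (S.time (n + 1))) + S.phaseShift W n (ω n).1 t := by
    intro t ht
    rw [phase, phase, S.solution_increment hX hs hsn ht, inner_add_left, inner_add_left,
      inner_smul_left, inner_smul_right (dir (ω n).1), inner_dir_nrm, phaseShift]
    ring
  rw [S.solution_increment hX hs hsn (right_mem_Icc.2 (S.time_succ_le n)), stepMap,
    ← S.integral_cutoff_mul_sin hW]
  refine congrArg (fun z => _ + (S.amp n * z) • dir (ω n).1)
    (intervalIntegral.integral_congr fun r hr => ?_)
  rw [uIcc_of_le (S.time_succ_le n)] at hr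
  rw [hphase r hr]

lemma solution_eq_flow (hW : ContinuousOn W (Icc 0 1)) (ω : ℕ → Fin 4 × Fin 4) (y : Space 2)
    (k n : ℕ) : solution (S.field ω) W (S.time (n + k)) y (S.time n) = S.flow W ω k n y := by
  have hX := (S.uniquelySolvable_field ω).isSolution_solution (hW.mono Ioc_subset_Icc_self)
    (S.time_mem (n + k)) y
  generalize hm : n + k = m at hX ⊢
  induction k generalizing n with
  | zero =>
    obtain rfl : n = m := hm
    rw [hX.2 _ ⟨le_rfl, S.time_le_one _⟩, flow]
    simp
  | succ k ih =>
    have hle : S.time m ≤ S.time (n + 1) := S.time_anti.antitone (by omega)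
    rw [S.solution_step hW hX (S.time_pos m) hle, flow, ih (n + 1) (by omega)]

/-! ### Size of the relative displacement under one shear -/

lemma abs_phaseShift_le (n : ℕ) (j : Fin 4) {r : ℝ}
    (h : ‖W r - W (S.time (n + 1))‖ ≤ S.len n / 8) : |S.phaseShift W n j r| ≤ 1 / 8 := by
  have hL := S.len_pos n
  refine (abs_real_inner_le_norm _ _).trans ?_
  rw [norm_frequency]
  calc _ ≤ S.len n / 8 * (S.len n)⁻¹ := by gcongr
    _ = _ := by field_simp

/-- This is |∫ χ exp(iθ)| ≤ ∫ χ for the cutoff χ, proved by projecting the integrand onto the vector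
(c, s) of its integrals. -/
lemma cosPart_sq_add_sinPart_sq_le (hW : ContinuousOn W (Icc 0 1)) (n : ℕ) (j : Fin 4) :
    S.cosPart W n j ^ 2 + S.sinPart W n j ^ 2 ≤ S.duration n ^ 2 := by
  set c := S.cosPart W n j with hc
  set s := S.sinPart W n j with hs
  set R := √(c ^ 2 + s ^ 2) with hR
  have hR2 : R ^ 2 = c ^ 2 + s ^ 2 := Real.sq_sqrt (by positivity)
  have hR0 : 0 ≤ R := Real.sqrt_nonneg _
  have hcos := S.intervalIntegrable_cos hW n j
  have hsin := S.intervalIntegrable_sin hW n j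
  have h1 : c ^ 2 + s ^ 2 = ∫ r in S.time (n + 1)..S.time n,
      (c * (S.cutoff n r * Real.cos (S.phaseShift W n j r)) +
        s * (S.cutoff n r * Real.sin (S.phaseShift W n j r))) := by
    rw [intervalIntegral.integral_add (hcos.const_mul _) (hsin.const_mul _),
      intervalIntegral.integral_const_mul, intervalIntegral.integral_const_mul, ← cosPart,
      ← sinPart, ← hc, ← hs]
    ring
  have h2 : c ^ 2 + s ^ 2 ≤ ∫ r in S.time (n + 1)..S.time n, S.cutoff n r * R := by
    rw [h1]
    refine intervalIntegral.integral_mono_on (S.time_succ_le n)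
      ((hcos.const_mul _).add (hsin.const_mul _))
      (S.intervalIntegrable_cutoff_mul continuousOn_const) fun r _ => ?_
    have h3 : c * Real.cos (S.phaseShift W n j r) + s * Real.sin (S.phaseShift W n j r) ≤ R := by
      refine Real.le_sqrt_of_sq_le ?_
      nlinarith [sq_nonneg (c * Real.sin (S.phaseShift W n j r) -
        s * Real.cos (S.phaseShift W n j r)), Real.sin_sq_add_cos_sq (S.phaseShift W n j r)]
    nlinarith [S.cutoff_nonneg n r]
  rw [intervalIntegral.integral_mul_const, integral_cutoff, ← duration, mul_comm] at h2
  rw [← hR2] at h2 ⊢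
  have hd := S.duration_pos n
  rcases hR0.eq_or_lt with h | h
  · rw [← h, zero_pow two_ne_zero]; exact sq_nonneg _
  · have : R ≤ S.duration n := by nlinarith
    gcongr

lemma le_cosPart (hW : ContinuousOn W (Icc 0 1)) (n : ℕ) (j : Fin 4)
    (h : ∀ r ∈ Icc (S.time (n + 1)) (S.time n), ‖W r - W (S.time (n + 1))‖ ≤ S.len n / 8) :
    (1 - 1 / 128) * S.duration n ≤ S.cosPart W n j := by
  have hcos := S.intervalIntegrable_cos hW n j
  rw [duration, ← integral_cutoff, ← intervalIntegral.integral_const_mul, cosPart]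
  refine intervalIntegral.integral_mono_on (S.time_succ_le n)
    (((S.continuous_cutoff n).intervalIntegrable _ _).const_mul _) hcos fun r hr => ?_
  have h1 := Real.one_sub_sq_div_two_le_cos (x := S.phaseShift W n j r)
  have h2 : S.phaseShift W n j r ^ 2 ≤ (1 / 8) ^ 2 :=
    sq_le_sq' (abs_le.1 (S.abs_phaseShift_le n j (h r hr))).1
      (abs_le.1 (S.abs_phaseShift_le n j (h r hr))).2
  rw [mul_comm]
  exact mul_le_mul_of_nonneg_left (by linarith) (S.cutoff_nonneg n r)

/-- The strength of the `n`-th shear. -/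
def strength (n : ℕ) : ℝ := S.amp n * S.duration n / S.len n

lemma strength_nonneg (n : ℕ) : 0 ≤ S.strength n :=
  div_nonneg (mul_nonneg (S.amp_nonneg n) (S.duration_pos n).le) (S.len_pos n).le

lemma mul_one_sub_le_sin_sq {u : ℝ} (h : |u| ≤ 1 / 8) : u ^ 2 * (1 - 1 / 128) ≤ Real.sin u ^ 2 := by
  have key : ∀ v : ℝ, 0 ≤ v → v ≤ 1 / 8 → v ^ 2 * (1 - 1 / 128) ≤ Real.sin v ^ 2 := by
    intro v h0 h1
    rcases h0.eq_or_lt with rfl | h0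
    · simp
    have h2 := (Real.sin_gt_sub_cube h0).le
    have h3 : v * (1 - 1 / 256) ≤ v - v ^ 3 / 6 := by nlinarith [mul_nonneg h0.le (sub_nonneg.2 h1)]
    have h4 : (v * (1 - 1 / 256)) ^ 2 ≤ Real.sin v ^ 2 :=
      pow_le_pow_left₀ (by nlinarith) (h3.trans h2) 2
    nlinarith [sq_nonneg v]
  rcases le_total 0 u with hu | hu
  · exact key u hu (by rwa [abs_of_nonneg hu] at h)
  · have := key (-u) (by linarith) (by rwa [abs_of_nonpos hu] at h)
    simpa using this

/-- The two displacements, for phases differing by a quarter turn, of the difference of two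
particles. -/
lemma exists_stepMap_sub (hW : ContinuousOn W (Icc 0 1)) (n : ℕ) (x y : Space 2) (j : Fin 4) :
    ∃ a b : ℝ, a ^ 2 + b ^ 2 ≤ S.strength n ^ 2 * inner ℝ (x - y) (nrm j) ^ 2 ∧
      ((∀ r ∈ Icc (S.time (n + 1)) (S.time n), ‖W r - W (S.time (n + 1))‖ ≤ S.len n / 8) →
        ‖x - y‖ ≤ S.len n / 4 →
        (1 - 1 / 32) * (S.strength n ^ 2 * inner ℝ (x - y) (nrm j) ^ 2) ≤ a ^ 2 + b ^ 2) ∧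
      ∀ l : Fin 4, S.stepMap W n (j, l) x - S.stepMap W n (j, l) y =
        x - y + ![a, b, -a, -b] l • dir j := by
  have hL := S.len_pos n
  set ν := (S.len n)⁻¹ • nrm j with hν
  set c := S.cosPart W n j with hc
  set s := S.sinPart W n j with hs
  set u : ℝ := inner ℝ (x - y) (nrm j) / (2 * S.len n) with hu
  set ψ : ℝ := (inner ℝ x ν + inner ℝ y ν) / 2 with hψ
  have hdiff : (inner ℝ x ν - inner ℝ y ν) / 2 = u := by
    rw [← inner_sub_left, hν, inner_smul_right, hu]
    field_simp
  -- A quarter turn of the phase rotates (cos ψ, -sin ψ) to an orthogonal vector, so the sum of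
  -- squares does not depend on the mean phase ψ of the two particles.
  have hsq : (S.amp n * (2 * Real.sin u * (Real.cos ψ * c - Real.sin ψ * s))) ^ 2 +
      (S.amp n * (2 * Real.sin u * (-Real.sin ψ * c - Real.cos ψ * s))) ^ 2 =
      4 * S.amp n ^ 2 * Real.sin u ^ 2 * (c ^ 2 + s ^ 2) := by
    linear_combination 4 * S.amp n ^ 2 * Real.sin u ^ 2 * (c ^ 2 + s ^ 2) *
      Real.sin_sq_add_cos_sq ψ
  have hstr : S.strength n ^ 2 * inner ℝ (x - y) (nrm j) ^ 2 =
      4 * S.amp n ^ 2 * u ^ 2 * S.duration n ^ 2 := by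
    rw [strength, hu]; field_simp; ring
  have hA := sq_nonneg (S.amp n)
  refine ⟨S.amp n * (2 * Real.sin u * (Real.cos ψ * c - Real.sin ψ * s)),
    S.amp n * (2 * Real.sin u * (-Real.sin ψ * c - Real.cos ψ * s)), ?_, ?_, ?_⟩
  · rw [hsq, hstr]
    have h1 : Real.sin u ^ 2 ≤ u ^ 2 := sq_le_sq.2 Real.abs_sin_le_abs
    have h2 := S.cosPart_sq_add_sinPart_sq_le hW n j
    gcongr
  · intro hsmall hxy
    rw [hsq, hstr]
    have h1 : |u| ≤ 1 / 8 := by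
      rw [hu, abs_div, abs_of_pos (by positivity : 0 < 2 * S.len n), div_le_iff₀ (by positivity)]
      have := abs_real_inner_le_norm (x - y) (nrm j)
      rw [norm_nrm, mul_one] at this
      linarith
    have h2 := mul_one_sub_le_sin_sq h1
    -- The loss 1/64 from the oscillation of `W` and the loss 1/128 from replacing sin u by u
    -- together stay below 1/32.
    have h3 : (1 - 1 / 64) * S.duration n ^ 2 ≤ c ^ 2 + s ^ 2 := by
      have hd := S.duration_pos n
      have h4 := pow_le_pow_left₀ (by positivity) (S.le_cosPart hW n j hsmall) 2
      rw [← hc] at h4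
      nlinarith [sq_nonneg s, sq_nonneg (S.duration n)]
    calc (1 - 1 / 32) * (4 * S.amp n ^ 2 * u ^ 2 * S.duration n ^ 2)
        ≤ 4 * S.amp n ^ 2 * (u ^ 2 * (1 - 1 / 128)) * ((1 - 1 / 64) * S.duration n ^ 2) := by
          have : 0 ≤ 4 * S.amp n ^ 2 * u ^ 2 * S.duration n ^ 2 := by positivity
          linarith
      _ ≤ _ := by gcongr
  · intro l
    have hk : ∀ z, S.phase n (j, l) z = inner ℝ z ν + l * (Real.pi / 2) := fun z => rfl
    have hmain : S.stepMap W n (j, l) x - S.stepMap W n (j, l) y = x - y +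
        (S.amp n * (2 * Real.sin u * (Real.cos (ψ + l * (Real.pi / 2)) * c -
          Real.sin (ψ + l * (Real.pi / 2)) * s))) • dir j := by
      have h1 := Real.sin_sub_sin (S.phase n (j, l) x) (S.phase n (j, l) y)
      have h2 := Real.cos_sub_cos (S.phase n (j, l) x) (S.phase n (j, l) y)
      rw [hk, hk, add_sub_add_right_eq_sub, hdiff] at h1 h2
      have h3 : (inner ℝ x ν + l * (Real.pi / 2) + (inner ℝ y ν + l * (Real.pi / 2))) / 2 =
          ψ + l * (Real.pi / 2) := by rw [hψ]; ring
      rw [h3] at h1 h2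
      rw [stepMap, stepMap, hk, hk]
      have h4 : ∀ (p q z : Space 2) (α β : ℝ), p + z + α • dir j - (q + z + β • dir j) =
          p - q + (α - β) • dir j := fun p q z α β => by rw [sub_smul]; abel
      rw [h4]
      congr 2
      linear_combination (S.amp n * c) * h1 + (S.amp n * s) * h2
    rw [hmain]
    congr 2
    fin_cases l
    · simp
    · simp [Real.cos_add_pi_div_two, Real.sin_add_pi_div_two]
    · have e : ψ + 2 * (Real.pi / 2) = ψ + Real.pi := by ring
      simp [e, Real.cos_add_pi, Real.sin_add_pi]
      ring
    · have e : ψ + 3 * (Real.pi / 2) = ψ + Real.pi + Real.pi / 2 := by ring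
      simp [e, Real.cos_add_pi, Real.sin_add_pi, Real.cos_add_pi_div_two,
        Real.sin_add_pi_div_two]
      ring

/-- A shear preserves the component of the difference across the shear. If that component is zero,
the relative displacement vanishes too. -/
lemma stepMap_injective (hW : ContinuousOn W (Icc 0 1)) {n : ℕ} (k : Fin 4 × Fin 4) :
    Function.Injective (S.stepMap W n k) := by
  intro x y hxy
  obtain ⟨a, b, hab, -, h⟩ := S.exists_stepMap_sub hW n x y k.1
  have h1 := h k.2
  rw [Prod.mk.eta, hxy, sub_self] at h1
  have h2 : inner ℝ (x - y) (nrm k.1) = (0 : ℝ) := by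
    have := congrArg (fun z => inner ℝ z (nrm k.1) : Space 2 → ℝ) h1
    simpa [inner_add_left, inner_smul_left, inner_dir_nrm] using this.symm
  rw [h2] at hab
  have ha : a = 0 := by nlinarith [sq_nonneg a, sq_nonneg b]
  have hb : b = 0 := by nlinarith [sq_nonneg a, sq_nonneg b]
  have h3 : (![a, b, -a, -b] : Fin 4 → ℝ) k.2 = 0 := by
    subst ha hb
    generalize k.2 = l
    fin_cases l <;> simp
  rw [h3, zero_smul, add_zero] at h1
  exact sub_eq_zero.1 h1.symm

lemma flow_injective (hW : ContinuousOn W (Icc 0 1)) (ω : ℕ → Fin 4 × Fin 4) (k n : ℕ) :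
    Function.Injective (S.flow W ω k n) := by
  induction k generalizing n with
  | zero => exact fun _ _ h => h
  | succ k ih => exact fun x y h => ih (n + 1) (S.stepMap_injective hW _ h)

/-- On average, a shear decreases the inverse distance of two close particles. -/
theorem average_stepMap_le (hW : ContinuousOn W (Icc 0 1)) {n : ℕ}
    (hκ : S.strength n ≤ 1 / 4000)
    (hsmall : ∀ r ∈ Icc (S.time (n + 1)) (S.time n),
      ‖W r - W (S.time (n + 1))‖ ≤ S.len n / 8) (x y : Space 2) :
    (∑ k, ‖S.stepMap W n k x - S.stepMap W n k y‖⁻¹) / 16 ≤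
      (1 - S.strength n ^ 2 / 64) * ‖x - y‖⁻¹ + 8 * S.strength n ^ 2 / S.len n := by
  have hL := S.len_pos n
  -- For coinciding points every inverse distance is 0 by the convention for division by zero, so
  -- only the nonnegative additive term remains.
  rcases eq_or_ne x y with rfl | hxy
  · simp; positivity
  choose a b hab hlow h using S.exists_stepMap_sub hW n x y
  refine le_trans (le_of_eq ?_) (average_inv_norm_le (sub_ne_zero.2 hxy) hL (S.strength_nonneg n)
    hκ hab fun hD j => hlow j hsmall hD)
  rw [Fintype.sum_prod_type]
  congr 1
  refine Finset.sum_congr rfl fun j _ => ?_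
  rw [Fin.sum_univ_four, h, h, h, h]
  rfl

end Schedule

/-! ### Explosive separation -/

/-- The uniform distribution on the directions and phases of a shear. -/
def uniformKey : Measure (Fin 4 × Fin 4) := (PMF.uniformOfFintype (Fin 4 × Fin 4)).toMeasure

instance : IsProbabilityMeasure uniformKey :=
  inferInstanceAs (IsProbabilityMeasure (PMF.uniformOfFintype (Fin 4 × Fin 4)).toMeasure)

/-- Independent, uniformly distributed directions and phases. -/
def noise : Measure (ℕ → Fin 4 × Fin 4) := Measure.infinitePi fun _ => uniformKey

instance : IsProbabilityMeasure noise :=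
  inferInstanceAs (IsProbabilityMeasure (Measure.infinitePi fun _ : ℕ => uniformKey))

lemma map_equiv_uniformKey (e : Fin 4 × Fin 4 ≃ Fin 4 × Fin 4) :
    uniformKey.map e = uniformKey := by
  classical
  ext s hs
  rw [Measure.map_apply .of_discrete hs, uniformKey,
    PMF.toMeasure_uniformOfFintype_apply _ hs, PMF.toMeasure_uniformOfFintype_apply _ .of_discrete]
  congr 2
  exact Fintype.card_congr (e.subtypeEquiv fun _ => Iff.rfl)

/-- The uniform law on a finite group is translation invariant. Translating a single coordinate thus
preserves the product law, which gives averaging over that coordinate without splitting the infinite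
product. -/
lemma measurePreserving_update_add (n : ℕ) (k : Fin 4 × Fin 4) :
    MeasurePreserving (fun ω : ℕ → Fin 4 × Fin 4 => Function.update ω n (ω n + k)) noise noise := by
  have h := Measure.infinitePi_map_pi (μ := fun _ : ℕ => uniformKey)
    (f := fun i => if i = n then (fun z => z + k) else id) (fun _ => .of_discrete)
  have h2 : (fun i : ℕ => uniformKey.map (if i = n then (fun z => z + k) else id)) =
      fun _ => uniformKey := by
    funext i
    split_ifs
    · exact map_equiv_uniformKey (Equiv.addRight k)
    · exact Measure.map_id
  have h3 : (fun ω : ℕ → Fin 4 × Fin 4 => Function.update ω n (ω n + k)) =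
      fun ω i => (if i = n then (fun z => z + k) else id) (ω i) := by
    funext ω i
    by_cases hi : i = n
    · subst hi; simp
    · simp [hi]
  rw [h3]
  refine ⟨measurable_pi_iff.2 fun i => Measurable.of_discrete.comp (measurable_pi_apply i), ?_⟩
  rw [noise, h]
  congr 1

/-- Averaging over one coordinate does not change the expectation. -/
lemma lintegral_noise_eq_average {F : (ℕ → Fin 4 × Fin 4) → ℝ≥0∞} (hF : Measurable F) (n : ℕ) :
    ∫⁻ ω, F ω ∂noise = ∫⁻ ω, (∑ k, F (Function.update ω n k)) / 16 ∂noise := by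
  have h1 : ∀ k, ∫⁻ ω, F (Function.update ω n (ω n + k)) ∂noise = ∫⁻ ω, F ω ∂noise := fun k =>
    (measurePreserving_update_add n k).lintegral_comp hF
  have h2 : ∀ k, Measurable fun ω : ℕ → Fin 4 × Fin 4 => F (Function.update ω n (ω n + k)) :=
    fun k => hF.comp (measurePreserving_update_add n k).measurable
  have h3 : ∀ ω : ℕ → Fin 4 × Fin 4, ∑ k, F (Function.update ω n k) =
      ∑ k, F (Function.update ω n (ω n + k)) := fun ω =>
    (Equiv.sum_comp (Equiv.addLeft (ω n)) fun k => F (Function.update ω n k)).symm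
  simp_rw [h3, div_eq_mul_inv]
  rw [lintegral_mul_const _ (Finset.measurable_fun_sum _ fun k _ => h2 k),
    lintegral_finsetSum _ fun k _ => h2 k]
  simp_rw [h1]
  rw [Finset.sum_const, Finset.card_univ, Fintype.card_prod, Fintype.card_fin, nsmul_eq_mul,
    mul_comm, ← mul_assoc]
  norm_num
  rw [ENNReal.inv_mul_cancel (by norm_num) (by norm_num), one_mul]

/-! ### Propagation of the inverse-distance bound along the flow -/

namespace Schedule

variable (S : Schedule) {W : ℝ → Space 2}

lemma continuous_stepMap (n : ℕ) (k : Fin 4 × Fin 4) : Continuous (S.stepMap W n k) := by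
  unfold stepMap phase
  fun_prop

lemma measurable_flow (k n : ℕ) (x : Space 2) : Measurable fun ω => S.flow W ω k n x := by
  induction k generalizing n with
  | zero => exact measurable_const
  | succ k ih =>
    have h : Measurable fun p : (Fin 4 × Fin 4) × Space 2 => S.stepMap W n p.1 p.2 :=
      measurable_from_prod_countable_right fun k => (S.continuous_stepMap n k).measurable
    exact h.comp ((measurable_pi_apply n).prodMk (ih (n + 1)))

/-- The flow that ends at the time with index n uses only shears of index at least n. This is the
independence behind the averaging step. -/
lemma flow_update {m n : ℕ} (h : m < n) (ω : ℕ → Fin 4 × Fin 4) (key : Fin 4 × Fin 4) (k : ℕ)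
    (x : Space 2) : S.flow W (Function.update ω m key) k n x = S.flow W ω k n x := by
  induction k generalizing n with
  | zero => rfl
  | succ k ih => rw [flow, flow, ih (h.trans n.lt_succ_self), Function.update_of_ne h.ne']

/-- The conditions under which the `n`-th shear separates particles. -/
structure Separates (W : ℝ → Space 2) (n : ℕ) : Prop where
  strength_le : S.strength n ≤ 1 / 4000
  path_le : ∀ r ∈ Icc (S.time (n + 1)) (S.time n), ‖W r - W (S.time (n + 1))‖ ≤ S.len n / 8
  len_le : S.len n ≤ S.len (n + 1) * (1 + S.strength n ^ 2 / 128)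

/-- Induction on the number of shears: average over the last one and apply the drift inequality. The
scale may grow by the factor 1 + κ²/128, half the contraction rate, and the other half absorbs the
additive term 8κ²/L. This fixes the constant 1024 = 8 · 128. -/
lemma lintegral_inv_norm_le (hW : ContinuousOn W (Icc 0 1)) {n₀ : ℕ}
    (hS : ∀ n, n₀ ≤ n → S.Separates W n) {x y : Space 2} (k n : ℕ) (hn : n₀ ≤ n)
    (hxy : ‖x - y‖⁻¹ ≤ 1024 / S.len (n + k)) :
    ∫⁻ ω, ENNReal.ofReal ‖S.flow W ω k n x - S.flow W ω k n y‖⁻¹ ∂noise ≤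
      ENNReal.ofReal (1024 / S.len n) := by
  induction k generalizing n with
  | zero =>
    simp only [flow, lintegral_const, measure_univ, mul_one]
    exact ENNReal.ofReal_le_ofReal hxy
  | succ k ih =>
    have hm : ∀ j m, Measurable fun ω =>
        ENNReal.ofReal ‖S.flow W ω j m x - S.flow W ω j m y‖⁻¹ := fun j m =>
      ((S.measurable_flow j m x).sub (S.measurable_flow j m y)).norm.inv.ennreal_ofReal
    have hL := S.len_pos n
    have hL' := S.len_pos (n + 1)
    obtain ⟨hκ, hpath, hlen⟩ := hS n hn
    set κ := S.strength n
    have hκ0 : 0 ≤ κ := S.strength_nonneg n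
    have hc : 0 ≤ 1 - κ ^ 2 / 64 := by nlinarith
    have hih := ih (n + 1) (by omega) (by rwa [show n + 1 + k = n + (k + 1) by omega])
    rw [lintegral_noise_eq_average (hm _ _) n]
    calc _ ≤ ∫⁻ ω, (ENNReal.ofReal (1 - κ ^ 2 / 64) *
          ENNReal.ofReal ‖S.flow W ω k (n + 1) x - S.flow W ω k (n + 1) y‖⁻¹ +
            ENNReal.ofReal (8 * κ ^ 2 / S.len n)) ∂noise := by
          refine lintegral_mono fun ω => ?_
          simp only [flow, Function.update_self, S.flow_update n.lt_succ_self]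
          have h := S.average_stepMap_le hW hκ hpath (S.flow W ω k (n + 1) x)
            (S.flow W ω k (n + 1) y)
          rw [← ENNReal.ofReal_mul hc, ← ENNReal.ofReal_add (by positivity) (by positivity),
            ← ENNReal.ofReal_sum_of_nonneg (fun _ _ => by positivity)]
          refine le_trans (le_of_eq ?_) (ENNReal.ofReal_le_ofReal h)
          rw [ENNReal.ofReal_div_of_pos (by norm_num), ENNReal.ofReal_ofNat]
      _ = ENNReal.ofReal (1 - κ ^ 2 / 64) *
          (∫⁻ ω, ENNReal.ofReal ‖S.flow W ω k (n + 1) x - S.flow W ω k (n + 1) y‖⁻¹ ∂noise) +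
            ENNReal.ofReal (8 * κ ^ 2 / S.len n) := by
          rw [lintegral_add_right _ measurable_const, lintegral_const_mul _ (hm _ _),
            lintegral_const, measure_univ, mul_one]
      _ ≤ ENNReal.ofReal (1 - κ ^ 2 / 64) * ENNReal.ofReal (1024 / S.len (n + 1)) +
            ENNReal.ofReal (8 * κ ^ 2 / S.len n) := by gcongr
      _ ≤ _ := by
          rw [← ENNReal.ofReal_mul hc, ← ENNReal.ofReal_add (by positivity) (by positivity)]
          refine ENNReal.ofReal_le_ofReal ?_
          have h1 : 1 / S.len (n + 1) ≤ (1 + κ ^ 2 / 128) / S.len n := by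
            rw [div_le_div_iff₀ hL' hL]; linarith
          calc (1 - κ ^ 2 / 64) * (1024 / S.len (n + 1)) + 8 * κ ^ 2 / S.len n
              = (1 - κ ^ 2 / 64) * 1024 * (1 / S.len (n + 1)) + 8 * κ ^ 2 / S.len n := by ring
            _ ≤ (1 - κ ^ 2 / 64) * 1024 * ((1 + κ ^ 2 / 128) / S.len n) +
                8 * κ ^ 2 / S.len n := by gcongr
            _ = (1024 - κ ^ 2 * κ ^ 2 / 8) / S.len n := by ring
            _ ≤ 1024 / S.len n := by gcongr; nlinarith [sq_nonneg (κ ^ 2)]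

lemma noise_norm_lt_le (hW : ContinuousOn W (Icc 0 1)) {n₀ : ℕ}
    (hS : ∀ n, n₀ ≤ n → S.Separates W n) {x y : Space 2} (hne : x ≠ y) (k n : ℕ) (hn : n₀ ≤ n)
    (hxy : ‖x - y‖⁻¹ ≤ 1024 / S.len (n + k)) {δ : ℝ} (hδ : 0 < δ) :
    noise {ω | ‖solution (S.field ω) W (S.time (n + k)) x (S.time n) -
      solution (S.field ω) W (S.time (n + k)) y (S.time n)‖ < δ} ≤
      ENNReal.ofReal (1024 / S.len n * δ) := by
  have hL := S.len_pos n
  simp only [S.solution_eq_flow hW]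
  have hm : Measurable fun ω => ENNReal.ofReal ‖S.flow W ω k n x - S.flow W ω k n y‖⁻¹ :=
    ((S.measurable_flow k n x).sub (S.measurable_flow k n y)).norm.inv.ennreal_ofReal
  have h1 : {ω | ‖S.flow W ω k n x - S.flow W ω k n y‖ < δ} ⊆
      {ω | ENNReal.ofReal δ⁻¹ ≤ ENNReal.ofReal ‖S.flow W ω k n x - S.flow W ω k n y‖⁻¹} := by
    intro ω hω
    refine ENNReal.ofReal_le_ofReal ?_
    -- Injectivity of the flow matters here: merged particles would have inverse distance 0 by
    -- convention and escape Markov's inequality.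
    have : 0 < ‖S.flow W ω k n x - S.flow W ω k n y‖ :=
      norm_pos_iff.2 (sub_ne_zero.2 fun h => hne (S.flow_injective hW ω k n h))
    exact inv_anti₀ this (le_of_lt hω)
  refine (measure_mono h1).trans ((meas_ge_le_lintegral_div hm.aemeasurable
    (by simpa using hδ) ENNReal.ofReal_ne_top).trans ?_)
  rw [ENNReal.div_le_iff (by simpa using hδ) ENNReal.ofReal_ne_top,
    ← ENNReal.ofReal_mul (by positivity), mul_assoc, mul_inv_cancel₀ hδ.ne', mul_one]
  exact S.lintegral_inv_norm_le hW hS k n hn hxy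

/-- If all but finitely many shears separate particles, then the random field is explosively
separating. -/
theorem explosivelySeparating_field (hW : ContinuousOn W (Icc 0 1))
    (hlen : Tendsto S.len atTop (𝓝 0)) (hS : ∀ᶠ n in atTop, S.Separates W n) :
    ExplosivelySeparating noise S.field S.time W := by
  obtain ⟨n₀, hS⟩ := eventually_atTop.1 hS
  -- The iterated upper limit is exactly 0 for every n ≥ n₀, because the bound 1024δ/L vanishes as δ
  -- → 0 with n fixed.
  refine tendsto_const_nhds.congr' ?_
  filter_upwards [eventually_ge_atTop n₀] with n hn
  refine (nonpos_iff_eq_zero.1 ?_).symm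
  have hlim : Tendsto (fun δ : ℝ => ENNReal.ofReal (1024 / S.len n * δ)) (𝓝[>] 0) (𝓝 0) := by
    have : Tendsto (fun δ : ℝ => ENNReal.ofReal (1024 / S.len n * δ)) (𝓝 0)
        (𝓝 (ENNReal.ofReal (1024 / S.len n * 0))) :=
      (ENNReal.continuous_ofReal.comp (continuous_const.mul continuous_id)).tendsto 0
    rw [mul_zero, ENNReal.ofReal_zero] at this
    exact this.mono_left nhdsWithin_le_nhds
  rw [← hlim.limsup_eq]
  refine limsup_le_limsup ?_
  filter_upwards [self_mem_nhdsWithin] with δ hδ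
  refine limsup_le_of_le (by isBoundedDefault) ?_
  have hpos : ∀ᶠ p in closePairs 2, 0 < ‖p.1 - p.2‖ :=
    tendsto_comap.eventually (self_mem_nhdsWithin : Ioi (0 : ℝ) ∈ 𝓝[>] 0)
  filter_upwards [hpos] with p hp
  refine limsup_le_of_le (by isBoundedDefault) ?_
  -- With the points fixed, the starting scale eventually falls below their distance, which supplies
  -- the initial bound of the induction.
  filter_upwards [eventually_ge_atTop n, hlen.eventually_lt_const hp] with m hm hlm
  obtain ⟨k, rfl⟩ := Nat.exists_eq_add_of_le hm
  refine S.noise_norm_lt_le hW hS (sub_ne_zero.1 (norm_pos_iff.1 hp)) k n hn ?_ hδ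
  rw [inv_le_comm₀ hp (div_pos (by norm_num) (S.len_pos _)), inv_div]
  linarith [S.len_pos (n + k)]

end Schedule

/-! ### Choice of the scales -/

lemma bumpMass_le_one : bumpMass ≤ 1 := by
  have h := intervalIntegral.integral_mono_on zero_le_one
    (continuous_bump.intervalIntegrable 0 1) (continuous_const.intervalIntegrable (μ := volume) 0 1)
    fun x _ => bump_le_one x
  simpa [bumpMass] using h

/-- The schedule with given switching times, whose shears have the size `1 / 2` in the norm of
order `α` and whose strength at the step `n` is proportional to `(n + 1) ^ (-1 / 2)`. -/
def scaledSchedule (α : ℝ) (s : ℕ → ℝ) (h0 : s 0 = 1) (hanti : StrictAnti s)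
    (hlim : Tendsto s atTop (𝓝 0)) : Schedule where
  time := s
  len n := (bumpMass / 1000 * (s n - s (n + 1)) * √(n + 1)) ^ (1 / (1 - α))
  amp n := ((bumpMass / 1000 * (s n - s (n + 1)) * √(n + 1)) ^ (1 / (1 - α))) ^ α / 2
  time_zero := h0
  time_anti := hanti
  time_tendsto := hlim
  amp_nonneg n := by
    have := sub_pos.2 (hanti n.lt_succ_self)
    have := bumpMass_pos
    positivity
  len_pos n := by
    have := sub_pos.2 (hanti n.lt_succ_self)
    have := bumpMass_pos
    positivity

section Scaled

variable {α : ℝ} {s : ℕ → ℝ} {h0 : s 0 = 1} {hanti : StrictAnti s} {hlim : Tendsto s atTop (𝓝 0)}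

local notation "𝒮" => scaledSchedule α s h0 hanti hlim

lemma scaled_len (n : ℕ) :
    (𝒮).len n = (bumpMass / 1000 * (𝒮).step n * √(n + 1)) ^ (1 / (1 - α)) := rfl

lemma scaled_amp (n : ℕ) : (𝒮).amp n = (𝒮).len n ^ α / 2 := rfl

/-- The strength is len ^ (α - 1) times step times bumpMass / 2, and the exponent 1 / (1 - α) in the
length is chosen to cancel the step and leave 500 / √(n + 1). -/
lemma scaled_strength (hα : α < 1) (n : ℕ) : (𝒮).strength n = 500 / √(n + 1) := by
  have hc := bumpMass_pos
  have ht := (𝒮).step_pos n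
  have hr : 0 < √((n : ℝ) + 1) := by positivity
  have hL := (𝒮).len_pos n
  have h1 : (𝒮).len n ^ α / (𝒮).len n = (bumpMass / 1000 * (𝒮).step n * √(n + 1))⁻¹ := by
    have h2 : (𝒮).len n ^ α / (𝒮).len n = (𝒮).len n ^ (α - 1) := (Real.rpow_sub_one hL.ne' α).symm
    rw [h2, scaled_len, ← Real.rpow_mul (by positivity), ← Real.rpow_neg_one]
    congr 1
    have : 1 - α ≠ 0 := by linarith
    field_simp
    ring
  calc (𝒮).strength n = (𝒮).len n ^ α / (𝒮).len n * ((𝒮).step n * bumpMass) / 2 := by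
        rw [Schedule.strength, Schedule.duration, scaled_amp]; ring
    _ = _ := by rw [h1]; field_simp; norm_num

/-- Quantitative control of the durations of the shears, from above. -/
def StepBound (s : ℕ → ℝ) (p : ℝ) : Prop :=
  (∀ n : ℕ, s n - s (n + 1) ≤ ((n : ℝ) + 1) ^ (-p)) ∧
    ∀ n : ℕ, s n - s (n + 1) ≤ (s (n + 1) - s (n + 2)) * (1 + 2 / ((n : ℝ) + 1)) ^ 3

lemma scaled_len_le (hα : α < 1) {p : ℝ} (hs : StepBound s p) (n : ℕ) :
    (𝒮).len n ≤ ((n : ℝ) + 1) ^ (1 / (1 - α) * (1 / 2 - p)) := by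
  have hc := bumpMass_pos
  have ht := (𝒮).step_pos n
  have hσ : 0 ≤ 1 / (1 - α) := by have := sub_pos.2 hα; positivity
  rw [scaled_len, mul_comm (1 / (1 - α)), Real.rpow_mul (by positivity)]
  refine Real.rpow_le_rpow (by positivity) ?_ hσ
  rw [sub_eq_neg_add, Real.rpow_add (by positivity), Real.sqrt_eq_rpow]
  refine mul_le_mul_of_nonneg_right ?_ (by positivity)
  calc bumpMass / 1000 * (𝒮).step n ≤ 1 * (𝒮).step n := by
        gcongr; linarith [bumpMass_le_one]
    _ ≤ _ := by rw [one_mul]; exact hs.1 n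

lemma scaled_len_le_one (hα : α < 1) {p : ℝ} (hp : 1 ≤ p) (hs : StepBound s p) (n : ℕ) :
    (𝒮).len n ≤ 1 := by
  refine (scaled_len_le hα hs n).trans (Real.rpow_le_one_of_one_le_of_nonpos ?_ ?_)
  · have : (0 : ℝ) ≤ n := n.cast_nonneg
    linarith
  · have := sub_pos.2 hα
    exact mul_nonpos_of_nonneg_of_nonpos (by positivity) (by linarith)

lemma tendsto_succ_rpow_neg {r : ℝ} (hr : r < 0) :
    Tendsto (fun n : ℕ => ((n : ℝ) + 1) ^ r) atTop (𝓝 0) := by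
  have h1 := tendsto_rpow_neg_atTop (neg_pos.2 hr)
  rw [neg_neg] at h1
  exact h1.comp (tendsto_atTop_add_const_right _ _ tendsto_natCast_atTop_atTop)

lemma tendsto_scaled_len (hα : α < 1) {p : ℝ} (hp : 1 ≤ p) (hs : StepBound s p) :
    Tendsto (𝒮).len atTop (𝓝 0) := by
  have hσ : 0 < 1 / (1 - α) := by have := sub_pos.2 hα; positivity
  exact squeeze_zero (fun n => ((𝒮).len_pos n).le) (scaled_len_le hα hs)
    (tendsto_succ_rpow_neg (mul_neg_of_pos_of_neg hσ (by linarith)))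

lemma one_add_pow_six_le {u : ℝ} (h0 : 0 ≤ u) (h2 : u ≤ 2) : (1 + u) ^ 6 ≤ 1 + 364 * u := by
  have e : 1 + 364 * u - (1 + u) ^ 6 = u * ((2 - u) * (u ^ 4 + 8 * u ^ 3 + 31 * u ^ 2 + 82 * u + 179)) := by
    ring
  have : 0 ≤ u * ((2 - u) * (u ^ 4 + 8 * u ^ 3 + 31 * u ^ 2 + 82 * u + 179)) :=
    mul_nonneg h0 (mul_nonneg (by linarith) (by positivity))
  linarith

/-- Since α < 1/2, the exponent 1 / (1 - α) is at most 2, so a step ratio of (1 + u)³ becomes at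
most (1 + u)⁶ ≤ 1 + 364u with u = 2/(n + 1). The allowance is 500²/128 > 728 over n + 1; the large
constant 500 serves this comparison. -/
lemma scaled_len_ratio (hα : α < 1 / 2) {p : ℝ} (hs : StepBound s p) (n : ℕ) :
    (𝒮).len n ≤ (𝒮).len (n + 1) * (1 + (𝒮).strength n ^ 2 / 128) := by
  have hc := bumpMass_pos
  have ht := (𝒮).step_pos n
  have ht' := (𝒮).step_pos (n + 1)
  have hn : (0 : ℝ) ≤ n := n.cast_nonneg
  have h1α : 0 < 1 - α := by linarith
  have hσ : 0 ≤ 1 / (1 - α) := by positivity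
  have hσ2 : 1 / (1 - α) ≤ 2 := by rw [div_le_iff₀ h1α]; linarith
  set u : ℝ := 2 / ((n : ℝ) + 1) with hu
  have hu0 : 0 ≤ u := by positivity
  have hu2 : u ≤ 2 := by rw [hu, div_le_iff₀ (by positivity)]; linarith
  have h1 : bumpMass / 1000 * (𝒮).step n * √(n + 1) ≤
      bumpMass / 1000 * (𝒮).step (n + 1) * √((n + 1 : ℕ) + 1) * (1 + u) ^ 3 := by
    have h2 : √((n : ℝ) + 1) ≤ √((n + 1 : ℕ) + 1) := Real.sqrt_le_sqrt (by push_cast; linarith)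
    calc _ ≤ bumpMass / 1000 * ((𝒮).step (n + 1) * (1 + u) ^ 3) * √((n + 1 : ℕ) + 1) := by
          gcongr
          exact hs.2 n
      _ = _ := by ring
  rw [scaled_strength (by linarith)]
  rw [scaled_len, scaled_len]
  refine (Real.rpow_le_rpow (by positivity) h1 hσ).trans ?_
  rw [Real.mul_rpow (by positivity) (by positivity)]
  refine mul_le_mul_of_nonneg_left ?_ (by positivity)
  calc ((1 + u) ^ 3) ^ (1 / (1 - α)) ≤ ((1 + u) ^ 3) ^ (2 : ℝ) :=
        Real.rpow_le_rpow_of_exponent_le (one_le_pow₀ (by linarith)) hσ2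
    _ = (1 + u) ^ 6 := by rw [Real.rpow_two]; ring
    _ ≤ 1 + 364 * u := one_add_pow_six_le hu0 hu2
    _ ≤ _ := by
      rw [div_pow, Real.sq_sqrt (by positivity), hu, add_le_add_iff_left, ← mul_div_assoc,
        div_div, div_le_div_iff₀ (by positivity) (by positivity)]
      nlinarith

/-- The path moves by at most a multiple of n ^ (-pβ) during a step, while the length is at least a
multiple of n ^ (-σ(q - 1/2)). The strict inequality of exponents absorbs the constants for large n.
-/
lemma eventually_path_le (hα : α < 1) {p q c β : ℝ} (hβ : 0 < β) (hs : StepBound s p) (hc : 0 < c)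
    (hlow : ∀ n : ℕ, c * ((n : ℝ) + 1) ^ (-q) ≤ s n - s (n + 1))
    (hpq : 1 / (1 - α) * (q - 1 / 2) < p * β) {W : ℝ → Space 2} (hW : HolderPath β W) :
    ∀ᶠ n in atTop, ∀ r ∈ Icc ((𝒮).time (n + 1)) ((𝒮).time n),
      ‖W r - W ((𝒮).time (n + 1))‖ ≤ (𝒮).len n / 8 := by
  obtain ⟨C, hC⟩ := hW
  have hb := bumpMass_pos
  have hσ : 0 ≤ 1 / (1 - α) := by have := sub_pos.2 hα; positivity
  set σ := 1 / (1 - α) with hσdef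
  have hlim : Tendsto (fun n : ℕ => C * ((n : ℝ) + 1) ^ (σ * (q - 1 / 2) - p * β)) atTop
      (𝓝 (C * 0)) := (tendsto_succ_rpow_neg (by linarith)).const_mul _
  rw [mul_zero] at hlim
  have hpos : 0 < (bumpMass / 1000 * c) ^ σ / 8 := by positivity
  filter_upwards [hlim.eventually_le_const hpos] with n hn r hr
  have hn1 : (0 : ℝ) < n + 1 := by positivity
  have h1 : ‖W r - W ((𝒮).time (n + 1))‖ ≤ C * ((n : ℝ) + 1) ^ (-(p * β)) := by
    have hmem := (𝒮).Icc_time_subset n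
    have h2 := hC.dist_le (hmem hr) (hmem (left_mem_Icc.2 ((𝒮).time_succ_le n)))
    rw [dist_eq_norm, Real.coe_toNNReal _ hβ.le] at h2
    refine h2.trans (mul_le_mul_of_nonneg_left ?_ C.2)
    rw [neg_mul_eq_neg_mul, Real.rpow_mul hn1.le]
    refine Real.rpow_le_rpow dist_nonneg ?_ hβ.le
    rw [Real.dist_eq, abs_of_nonneg (by linarith [hr.1])]
    exact (sub_le_sub_right hr.2 _).trans (hs.1 n)
  have h3 : (bumpMass / 1000 * c) ^ σ * ((n : ℝ) + 1) ^ (-(σ * (q - 1 / 2))) ≤ (𝒮).len n := by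
    rw [scaled_len, ← hσdef, neg_mul_eq_mul_neg, mul_comm σ, Real.rpow_mul hn1.le,
      ← Real.mul_rpow (by positivity) (by positivity)]
    refine Real.rpow_le_rpow (by positivity) ?_ hσ
    rw [neg_sub, sub_eq_neg_add, Real.rpow_add hn1, Real.sqrt_eq_rpow, ← mul_assoc]
    refine mul_le_mul_of_nonneg_right ?_ (by positivity)
    rw [mul_assoc]
    exact mul_le_mul_of_nonneg_left (hlow n) (by positivity)
  calc _ ≤ C * ((n : ℝ) + 1) ^ (-(p * β)) := h1
    _ = C * ((n : ℝ) + 1) ^ (σ * (q - 1 / 2) - p * β) * ((n : ℝ) + 1) ^ (-(σ * (q - 1 / 2))) := by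
        rw [mul_assoc, ← Real.rpow_add hn1]; congr 2; ring
    _ ≤ (bumpMass / 1000 * c) ^ σ / 8 * ((n : ℝ) + 1) ^ (-(σ * (q - 1 / 2))) := by gcongr
    _ ≤ _ := by linarith

lemma explosivelySeparating_scaled (hα : α < 1 / 2) {p q c β : ℝ} (hp : 1 ≤ p) (hβ : 0 < β)
    (hs : StepBound s p) (hc : 0 < c)
    (hlow : ∀ n : ℕ, c * ((n : ℝ) + 1) ^ (-q) ≤ s n - s (n + 1))
    (hpq : 1 / (1 - α) * (q - 1 / 2) < p * β) {W : ℝ → Space 2} (hW : HolderPath β W) :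
    ExplosivelySeparating noise (𝒮).field s W := by
  have hcont : ContinuousOn W (Icc 0 1) := by
    obtain ⟨C, hC⟩ := hW
    exact hC.continuousOn (Real.toNNReal_pos.2 hβ)
  refine (𝒮).explosivelySeparating_field hcont (tendsto_scaled_len (by linarith) hp hs) ?_
  have hstr : Tendsto (fun n : ℕ => 500 * ((n : ℝ) + 1) ^ (-(1 / 2) : ℝ)) atTop (𝓝 (500 * 0)) :=
    (tendsto_succ_rpow_neg (by norm_num)).const_mul _
  rw [mul_zero] at hstr
  filter_upwards [eventually_path_le (h0 := h0) (hanti := hanti) (hlim := hlim) (by linarith) hβ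
    hs hc hlow hpq hW, hstr.eventually_le_const (show (0 : ℝ) < 1 / 4000 by norm_num)] with n h1 h2
  refine ⟨?_, h1, scaled_len_ratio hα hs n⟩
  rw [scaled_strength (by linarith), Real.sqrt_eq_rpow, div_eq_mul_inv,
    ← Real.rpow_neg (by positivity)]
  exact h2

/-- Amplitude times step is strength times length over `bumpMass`, hence of order n ^ (-1/2 - σ(p -
1/2)) at most. -/
lemma summable_scaled (hα : α < 1) {p : ℝ} (hs : StepBound s p)
    (hp : 1 / 2 < 1 / (1 - α) * (p - 1 / 2)) :
    Summable fun n => (𝒮).amp n * (𝒮).step n := by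
  have hb := bumpMass_pos
  have hsum : Summable fun n : ℕ => 500 / bumpMass *
      ((n : ℝ) + 1) ^ (-(1 / 2) + 1 / (1 - α) * (1 / 2 - p)) := by
    refine Summable.mul_left _ ?_
    have := (summable_nat_add_iff 1).2 (Real.summable_nat_rpow
      (p := -(1 / 2) + 1 / (1 - α) * (1 / 2 - p))|>.2 (by
        have : 1 / (1 - α) * (1 / 2 - p) = - (1 / (1 - α) * (p - 1 / 2)) := by ring
        rw [this]; linarith))
    simpa using this
  refine Summable.of_nonneg_of_le
    (fun n => mul_nonneg ((𝒮).amp_nonneg n) ((𝒮).step_pos n).le) (fun n => ?_) hsum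
  have hn1 : (0 : ℝ) < n + 1 := by positivity
  have hL := (𝒮).len_pos n
  have h1 : (𝒮).amp n * (𝒮).step n = (𝒮).strength n * (𝒮).len n / bumpMass := by
    rw [Schedule.strength, Schedule.duration]; field_simp
  rw [h1, scaled_strength hα, Real.rpow_add hn1, Real.rpow_neg hn1.le, ← Real.sqrt_eq_rpow]
  calc 500 / √((n : ℝ) + 1) * (𝒮).len n / bumpMass
      ≤ 500 / √((n : ℝ) + 1) * ((n : ℝ) + 1) ^ (1 / (1 - α) * (1 / 2 - p)) / bumpMass := by
        gcongr; exact scaled_len_le hα hs n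
    _ = _ := by ring

end Scaled

/-! ### Logarithmic times -/

/-- Logarithmically decaying switching times. -/
def logTime (n : ℕ) : ℝ := (1 + Real.log (n + 1))⁻¹

lemma one_le_one_add_log (n : ℕ) : 1 ≤ 1 + Real.log ((n : ℝ) + 1) := by
  have := Real.log_nonneg (show (1 : ℝ) ≤ n + 1 by have : (0 : ℝ) ≤ n := n.cast_nonneg; linarith)
  linarith

lemma logTime_zero : logTime 0 = 1 := by simp [logTime]

lemma strictAnti_logTime : StrictAnti logTime := by
  refine strictAnti_nat_of_succ_lt fun n => ?_
  refine inv_strictAnti₀ (by linarith [one_le_one_add_log n]) ?_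
  have := Real.log_lt_log (show (0 : ℝ) < n + 1 by positivity)
    (show (n : ℝ) + 1 < (n + 1 : ℕ) + 1 by push_cast; linarith)
  linarith

lemma tendsto_logTime : Tendsto logTime atTop (𝓝 0) := by
  refine tendsto_inv_atTop_zero.comp (tendsto_atTop_add_const_left _ _ ?_)
  exact Real.tendsto_log_atTop.comp (tendsto_atTop_add_const_right _ _ tendsto_natCast_atTop_atTop)

lemma logTime_sub (n : ℕ) : logTime n - logTime (n + 1) =
    (Real.log ((n : ℝ) + 2) - Real.log (n + 1)) /
      ((1 + Real.log ((n : ℝ) + 1)) * (1 + Real.log (n + 2))) := by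
  have h1 := one_le_one_add_log n
  have h2 := one_le_one_add_log (n + 1)
  have e : ((n + 1 : ℕ) : ℝ) + 1 = n + 2 := by push_cast; ring
  rw [e] at h2
  rw [logTime, logTime, e]
  field_simp
  ring

lemma log_sub_log_le {x y : ℝ} (hx : 0 < x) (hy : 0 < y) :
    Real.log y - Real.log x ≤ (y - x) / x := by
  rw [← Real.log_div hy.ne' hx.ne', sub_div, div_self hx.ne']
  exact Real.log_le_sub_one_of_pos (by positivity)

lemma le_log_sub_log {x y : ℝ} (hx : 0 < x) (hy : 0 < y) :
    (y - x) / y ≤ Real.log y - Real.log x := by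
  have h := log_sub_log_le hy hx
  have : (x - y) / y = -((y - x) / y) := by ring
  linarith

lemma stepBound_logTime : StepBound logTime 1 := by
  refine ⟨fun n => ?_, fun n => ?_⟩
  · have hn : (0 : ℝ) ≤ n := n.cast_nonneg
    have h1 := one_le_one_add_log n
    have h2 := one_le_one_add_log (n + 1)
    have e : ((n + 1 : ℕ) : ℝ) + 1 = n + 2 := by push_cast; ring
    rw [e] at h2
    have h3 := log_sub_log_le (show (0 : ℝ) < n + 1 by positivity) (show (0 : ℝ) < n + 2 by positivity)
    rw [logTime_sub, Real.rpow_neg_one, div_le_iff₀ (by positivity)]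
    have h4 : ((n : ℝ) + 2 - (n + 1)) / (n + 1) = ((n : ℝ) + 1)⁻¹ := by
      rw [inv_eq_one_div]; congr 1; ring
    rw [h4] at h3
    refine h3.trans (le_mul_of_one_le_right (by positivity) ?_)
    exact one_le_mul_of_one_le_of_one_le h1 h2
  · have hn : (0 : ℝ) ≤ n := n.cast_nonneg
    have h1 := one_le_one_add_log n
    have h2 := one_le_one_add_log (n + 1)
    have h3 := one_le_one_add_log (n + 2)
    have e1 : ((n + 1 : ℕ) : ℝ) + 1 = n + 2 := by push_cast; ring
    have e2 : ((n + 2 : ℕ) : ℝ) + 1 = n + 3 := by push_cast; ring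
    have e3 : ((n + 1 : ℕ) : ℝ) + 2 = n + 3 := by push_cast; ring
    have hs := logTime_sub (n + 1)
    rw [e1, e3] at hs
    rw [e1] at h2
    rw [e2] at h3
    rw [logTime_sub, hs]
    have hm : (0 : ℝ) < n + 1 := by positivity
    have ha := log_sub_log_le hm (show (0 : ℝ) < n + 2 by positivity)
    have hb := le_log_sub_log (show (0 : ℝ) < n + 2 by positivity)
      (show (0 : ℝ) < n + 3 by positivity)
    have hc := log_sub_log_le hm (show (0 : ℝ) < n + 3 by positivity)
    rw [show (n : ℝ) + 2 - (n + 1) = 1 by ring] at ha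
    rw [show (n : ℝ) + 3 - (n + 2) = 1 by ring] at hb
    rw [show (n : ℝ) + 3 - (n + 1) = 2 by ring] at hc
    have hu : 0 < 2 / ((n : ℝ) + 1) := by positivity
    have hab : Real.log ((n : ℝ) + 2) - Real.log (n + 1) ≤
        (Real.log ((n : ℝ) + 3) - Real.log (n + 2)) * (1 + 2 / ((n : ℝ) + 1)) := by
      refine ha.trans (le_trans (le_of_eq ?_) (mul_le_mul_of_nonneg_right hb (by positivity)))
      field_simp
      ring
    generalize 2 / ((n : ℝ) + 1) = u at *
    generalize Real.log ((n : ℝ) + 1) = l₁ at *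
    generalize Real.log ((n : ℝ) + 2) = l₂ at *
    generalize Real.log ((n : ℝ) + 3) = l₃ at *
    have hl : 0 ≤ l₃ - l₂ := le_trans (by positivity) hb
    -- One factor 1 + u pays for the ratio of the logarithmic increments and another for the ratio
    -- of the denominators. The third is slack, so that one bound fits both families of times.
    have h13 : 1 + l₃ ≤ (1 + l₁) * (1 + u) := by nlinarith
    rw [div_mul_eq_mul_div, div_le_div_iff₀ (by positivity) (by positivity)]
    calc (l₂ - l₁) * ((1 + l₂) * (1 + l₃))
        ≤ ((l₃ - l₂) * (1 + u)) * ((1 + l₂) * ((1 + l₁) * (1 + u))) := by gcongr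
      _ = (l₃ - l₂) * (1 + u) ^ 2 * ((1 + l₁) * (1 + l₂)) := by ring
      _ ≤ (l₃ - l₂) * (1 + u) ^ 3 * ((1 + l₁) * (1 + l₂)) := by
        gcongr <;> linarith

/-- The steps are of order 1/(n log² n), and any positive power of n absorbs the logarithms. -/
lemma exists_le_logTime_sub {q : ℝ} (hq : 1 < q) :
    ∃ c : ℝ, 0 < c ∧ ∀ n : ℕ, c * ((n : ℝ) + 1) ^ (-q) ≤ logTime n - logTime (n + 1) := by
  obtain ⟨ε, hε, rfl⟩ : ∃ ε : ℝ, 0 < ε ∧ q = 1 + 2 * ε := ⟨(q - 1) / 2, by linarith, by ring⟩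
  refine ⟨(2 ^ (1 + 2 * ε))⁻¹ * ((1 + 1 / ε) ^ 2)⁻¹, by positivity, fun n => ?_⟩
  have hn : (0 : ℝ) ≤ n := n.cast_nonneg
  have hy : (0 : ℝ) < n + 2 := by positivity
  have h1 := one_le_one_add_log n
  have h2 : 1 + Real.log ((n : ℝ) + 2) ≤ (1 + 1 / ε) * ((n : ℝ) + 2) ^ ε := by
    have h3 := Real.log_le_rpow_div hy.le hε
    have h4 := Real.one_le_rpow (show (1 : ℝ) ≤ n + 2 by linarith) hε.le
    rw [add_mul, one_mul, one_div_mul_eq_div]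
    linarith
  have h5 : Real.log ((n : ℝ) + 1) ≤ Real.log (n + 2) :=
    Real.log_le_log (by positivity) (by linarith)
  have h6 := le_log_sub_log (show (0 : ℝ) < n + 1 by positivity) hy
  have h7 : ((n : ℝ) + 2 - (n + 1)) / (n + 2) = ((n : ℝ) + 2)⁻¹ := by
    rw [inv_eq_one_div]; congr 1; ring
  rw [h7] at h6
  have h8 : ((n : ℝ) + 2) ^ (1 + 2 * ε) ≤ 2 ^ (1 + 2 * ε) * ((n : ℝ) + 1) ^ (1 + 2 * ε) := by
    rw [← Real.mul_rpow (by norm_num) (by positivity)]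
    exact Real.rpow_le_rpow hy.le (by linarith) (by positivity)
  rw [logTime_sub, Real.rpow_neg (by positivity)]
  calc _ = (2 ^ (1 + 2 * ε) * ((n : ℝ) + 1) ^ (1 + 2 * ε))⁻¹ * ((1 + 1 / ε) ^ 2)⁻¹ := by
        rw [mul_inv]; ring
    _ ≤ (((n : ℝ) + 2) ^ (1 + 2 * ε))⁻¹ * ((1 + 1 / ε) ^ 2)⁻¹ := by gcongr
    _ = ((n : ℝ) + 2)⁻¹ / (((1 + 1 / ε) * ((n : ℝ) + 2) ^ ε) * ((1 + 1 / ε) * (n + 2) ^ ε)) := by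
        rw [Real.rpow_add hy, Real.rpow_one, two_mul, Real.rpow_add hy]
        field_simp
    _ ≤ _ := by
        gcongr
        · nlinarith
        · linarith
        · linarith

/-! ### Power times -/

/-- Polynomially decaying switching times. -/
def powTime (γ : ℝ) (n : ℕ) : ℝ := ((n : ℝ) + 1) ^ (-γ)

lemma powTime_zero (γ : ℝ) : powTime γ 0 = 1 := by simp [powTime]

lemma strictAnti_powTime {γ : ℝ} (hγ : 0 < γ) : StrictAnti (powTime γ) := by
  refine strictAnti_nat_of_succ_lt fun n => ?_
  exact Real.rpow_lt_rpow_of_neg (by positivity) (by push_cast; linarith) (by linarith)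

lemma tendsto_powTime {γ : ℝ} (hγ : 0 < γ) : Tendsto (powTime γ) atTop (𝓝 0) :=
  tendsto_succ_rpow_neg (by linarith)

/-- Mean value theorem for x ^ (-γ), whose derivative is monotone between n + 1 and n + 2. -/
lemma powTime_sub_mem {γ : ℝ} (hγ : 0 < γ) (n : ℕ) :
    powTime γ n - powTime γ (n + 1) ∈
      Icc (γ * ((n : ℝ) + 2) ^ (-(1 + γ))) (γ * ((n : ℝ) + 1) ^ (-(1 + γ))) := by
  have hn : (0 : ℝ) ≤ n := n.cast_nonneg
  have hd : ∀ x : ℝ, 0 < x → HasDerivAt (fun x : ℝ => x ^ (-γ)) (-γ * x ^ (-γ - 1)) x :=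
    fun x hx => Real.hasDerivAt_rpow_const (Or.inl hx.ne')
  obtain ⟨ξ, hξ, h⟩ := exists_hasDerivAt_eq_slope (fun x : ℝ => x ^ (-γ))
    (fun x => -γ * x ^ (-γ - 1)) (show (n : ℝ) + 1 < n + 2 by linarith)
    (fun x hx => (hd x (by linarith [hx.1])).continuousAt.continuousWithinAt)
    (fun x hx => hd x (by linarith [hx.1]))
  have e : ((n + 1 : ℕ) : ℝ) + 1 = n + 2 := by push_cast; ring
  have h1 : powTime γ n - powTime γ (n + 1) = γ * ξ ^ (-(1 + γ)) := by
    rw [powTime, powTime, e]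
    have e2 : (n : ℝ) + 2 - (n + 1) = 1 := by ring
    rw [e2, div_one] at h
    have e3 : -γ - 1 = -(1 + γ) := by ring
    rw [e3] at h
    linarith
  have hξ0 : 0 < ξ := by linarith [hξ.1]
  rw [h1]
  exact ⟨mul_le_mul_of_nonneg_left
      (Real.rpow_le_rpow_of_nonpos hξ0 hξ.2.le (by linarith)) hγ.le,
    mul_le_mul_of_nonneg_left
      (Real.rpow_le_rpow_of_nonpos (by positivity) hξ.1.le (by linarith)) hγ.le⟩

lemma stepBound_powTime {γ : ℝ} (hγ : 0 < γ) (hγ1 : γ ≤ 1) : StepBound (powTime γ) (1 + γ) := by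
  refine ⟨fun n => ?_, fun n => ?_⟩
  · exact (powTime_sub_mem hγ n).2.trans (mul_le_of_le_one_left (by positivity) hγ1)
  · have hn : (0 : ℝ) ≤ n := n.cast_nonneg
    have h1 := (powTime_sub_mem hγ n).2
    have h2 := (powTime_sub_mem hγ (n + 1)).1
    have e : ((n + 1 : ℕ) : ℝ) + 2 = n + 3 := by push_cast; ring
    rw [e] at h2
    have e2 : ((n : ℝ) + 1) ^ (-(1 + γ)) = (n + 3) ^ (-(1 + γ)) * (1 + 2 / (n + 1)) ^ (1 + γ) := by
      have e3 : 1 + 2 / ((n : ℝ) + 1) = (n + 3) / (n + 1) := by field_simp; ring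
      rw [e3, Real.div_rpow (by positivity) (by positivity), Real.rpow_neg (by positivity),
        Real.rpow_neg (by positivity)]
      field_simp
    have h3 : (1 + 2 / ((n : ℝ) + 1)) ^ (1 + γ) ≤ (1 + 2 / ((n : ℝ) + 1)) ^ 3 := by
      rw [← Real.rpow_natCast]
      refine Real.rpow_le_rpow_of_exponent_le ?_ (by push_cast; linarith)
      have : 0 ≤ 2 / ((n : ℝ) + 1) := by positivity
      linarith
    calc _ ≤ γ * ((n : ℝ) + 3) ^ (-(1 + γ)) * (1 + 2 / (n + 1)) ^ (1 + γ) := by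
          rw [mul_assoc, ← e2]; exact h1
      _ ≤ _ := mul_le_mul h2 h3 (by positivity) (h2.trans' (by positivity))

lemma le_powTime_sub {γ : ℝ} (hγ : 0 < γ) (n : ℕ) :
    γ * 2 ^ (-(1 + γ)) * ((n : ℝ) + 1) ^ (-(1 + γ)) ≤ powTime γ n - powTime γ (n + 1) := by
  have hn : (0 : ℝ) ≤ n := n.cast_nonneg
  refine le_trans ?_ (powTime_sub_mem hγ n).1
  rw [mul_assoc, ← Real.mul_rpow (by norm_num) (by positivity)]
  exact mul_le_mul_of_nonneg_left
    (Real.rpow_le_rpow_of_nonpos (by positivity) (by linarith) (by linarith)) hγ.le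

/-! ### The main theorem -/

lemma exists_explosivelySeparating_log {α : ℝ} (hα : α < 1 / 2) :
    ∃ (Ω : Type) (_ : MeasurableSpace Ω) (P : Measure Ω) (_ : IsProbabilityMeasure P)
      (v : Ω → ℝ → Space 2 → Space 2),
      (∀ t ∈ Icc (0 : ℝ) 1, ∀ x, Measurable (fun ω => v ω t x)) ∧
      (∀ ω, ∀ t ∈ Icc (0 : ℝ) 1, cNorm α (v ω t) ≤ 2) ∧
      (∀ ω, SmoothPositiveTimes (v ω)) ∧
      (∀ ω, UniquelySolvable (v ω)) ∧
      ∃ T : ℕ → ℝ, (∀ n, T n ∈ Ioc (0 : ℝ) 1) ∧ Tendsto T atTop (𝓝 0) ∧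
        ∀ β : ℝ, 1 / (2 * (1 - α)) < β → β ≤ 1 →
          ∀ W : ℝ → Space 2, HolderPath β W → ExplosivelySeparating P v T W := by
  have h1α : 0 < 1 - α := by linarith
  let S := scaledSchedule α logTime logTime_zero strictAnti_logTime tendsto_logTime
  refine ⟨ℕ → Fin 4 × Fin 4, inferInstance, noise, inferInstance, S.field,
    fun t _ x => S.measurable_field t x,
    fun ω t _ => S.cNorm_field_le ω (by linarith)
      (scaled_len_le_one (by linarith) le_rfl stepBound_logTime) (fun n => le_rfl) t,
    S.smoothPositiveTimes_field, S.uniquelySolvable_field, logTime, S.time_mem,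
    tendsto_logTime, fun β hβ _ W hW => ?_⟩
  have hβ0 : 0 < β := hβ.trans' (by positivity)
  have hσ : 1 / (2 * (1 - α)) = 1 / (1 - α) / 2 := by field_simp
  rw [hσ] at hβ
  have hσ0 : 0 < 1 / (1 - α) := by positivity
  set σ := 1 / (1 - α)
  -- This q > 1 places σ(q - 1/2) midway between σ/2 and β. It depends on β, but only the analysis
  -- uses it; the times and the field do not.
  obtain ⟨c, hc, hlow⟩ := exists_le_logTime_sub (q := 1 + (β - σ / 2) / (2 * σ))
    (by have : 0 < (β - σ / 2) / (2 * σ) := div_pos (by linarith) (by linarith)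
        linarith)
  refine explosivelySeparating_scaled hα le_rfl hβ0 stepBound_logTime hc hlow ?_ hW
  have : σ * (1 + (β - σ / 2) / (2 * σ) - 1 / 2) = σ / 2 + (β - σ / 2) / 2 := by
    field_simp; ring
  change σ * _ < _
  rw [this]
  linarith

lemma exists_explosivelySeparating_pow {ρ : ℝ} (hρ : 0 < ρ) (hρ2 : ρ < 1 / 2) :
    ∃ (Ω : Type) (_ : MeasurableSpace Ω) (P : Measure Ω) (_ : IsProbabilityMeasure P)
      (u : Ω → ℝ → Space 2 → Space 2),
      (∀ t ∈ Icc (0 : ℝ) 1, ∀ x, Measurable (fun ω => u ω t x)) ∧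
      (∀ ω, ∀ t ∈ Icc (0 : ℝ) 1, cNorm (-ρ) (u ω t) ≤ 2) ∧
      (∀ ω, MemL1C0 (u ω)) ∧
      (∀ ω, SmoothPositiveTimes (u ω)) ∧
      (∀ ω, UniquelySolvable (u ω)) ∧
      ∃ T : ℕ → ℝ, (∀ n, T n ∈ Ioc (0 : ℝ) 1) ∧ Tendsto T atTop (𝓝 0) ∧
        ∀ W : ℝ → Space 2, HolderPath ((1 + ρ / 8) / (2 + ρ / 2)) W →
          ExplosivelySeparating P u T W := by
  -- Integrability in time requires γ > ρ/2, while the Hölder exponent of the path requires γ < 7ρ/8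
  -- to leading order in ρ. The value 3ρ/4 lies between.
  have hγ : 0 < 3 * ρ / 4 := by linarith
  have hs := stepBound_powTime hγ (by linarith)
  let S := scaledSchedule (-ρ) (powTime (3 * ρ / 4)) (powTime_zero _) (strictAnti_powTime hγ)
    (tendsto_powTime hγ)
  refine ⟨ℕ → Fin 4 × Fin 4, inferInstance, noise, inferInstance, S.field,
    fun t _ x => S.measurable_field t x,
    fun ω t _ => S.cNorm_field_le ω (by linarith)
      (scaled_len_le_one (by linarith) (by linarith) hs) (fun n => le_rfl) t,
    fun ω => S.memL1C0_field ω (summable_scaled (by linarith) hs ?_),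
    S.smoothPositiveTimes_field, S.uniquelySolvable_field, powTime (3 * ρ / 4), S.time_mem,
    tendsto_powTime hγ, fun W hW => ?_⟩
  · rw [sub_neg_eq_add, one_div_mul_eq_div, lt_div_iff₀ (by linarith)]
    linarith
  · refine explosivelySeparating_scaled (by linarith) (by linarith) (by positivity) hs
      (by positivity) (le_powTime_sub hγ) ?_ hW
    rw [sub_neg_eq_add, one_div_mul_eq_div, mul_div_assoc', div_lt_div_iff₀ (by linarith)
      (by linarith)]
    nlinarith [pow_pos hρ 3, pow_pos hρ 2]

end ExplosiveSeparation
end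

theorem theorem1p6 :
    (∀ α : ℝ, α < 1 / 2 →
      ∃ (Ω : Type) (_ : MeasurableSpace Ω) (P : Measure Ω) (_ : IsProbabilityMeasure P)
        (v : Ω → ℝ → ExplosiveSeparation.Space 2 → ExplosiveSeparation.Space 2),
        (∀ t ∈ Icc (0 : ℝ) 1, ∀ x, Measurable (fun ω => v ω t x)) ∧
        (∀ ω, ∀ t ∈ Icc (0 : ℝ) 1, ExplosiveSeparation.cNorm α (v ω t) ≤ 2) ∧
        (∀ ω, ExplosiveSeparation.SmoothPositiveTimes (v ω)) ∧
        (∀ ω, ExplosiveSeparation.UniquelySolvable (v ω)) ∧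
        ∃ T : ℕ → ℝ, (∀ n, T n ∈ Ioc (0 : ℝ) 1) ∧ Tendsto T atTop (𝓝 0) ∧
          ∀ β : ℝ, 1 / (2 * (1 - α)) < β → β ≤ 1 →
            ∀ W : ℝ → ExplosiveSeparation.Space 2, ExplosiveSeparation.HolderPath β W →
              ExplosiveSeparation.ExplosivelySeparating P v T W) ∧
    (∀ ρ : ℝ, 0 < ρ → ρ < 1 / 2 →
      ∃ (Ω : Type) (_ : MeasurableSpace Ω) (P : Measure Ω) (_ : IsProbabilityMeasure P)
        (u : Ω → ℝ → ExplosiveSeparation.Space 2 → ExplosiveSeparation.Space 2),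
        (∀ t ∈ Icc (0 : ℝ) 1, ∀ x, Measurable (fun ω => u ω t x)) ∧
        (∀ ω, ∀ t ∈ Icc (0 : ℝ) 1, ExplosiveSeparation.cNorm (-ρ) (u ω t) ≤ 2) ∧
        (∀ ω, ExplosiveSeparation.MemL1C0 (u ω)) ∧
        (∀ ω, ExplosiveSeparation.SmoothPositiveTimes (u ω)) ∧
        (∀ ω, ExplosiveSeparation.UniquelySolvable (u ω)) ∧
        ∃ T : ℕ → ℝ, (∀ n, T n ∈ Ioc (0 : ℝ) 1) ∧ Tendsto T atTop (𝓝 0) ∧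
          ∀ W : ℝ → ExplosiveSeparation.Space 2,
            ExplosiveSeparation.HolderPath ((1 + ρ / 8) / (2 + ρ / 2)) W →
              ExplosiveSeparation.ExplosivelySeparating P u T W) :=
  ⟨fun _ hα => ExplosiveSeparation.exists_explosivelySeparating_log hα,
    fun _ hρ hρ2 => ExplosiveSeparation.exists_explosivelySeparating_pow hρ hρ2⟩
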